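/- Let $C=\mathbb{R}+e\mathbb{R}$, $e^2=1$, be the algebra of para-complex numbers. Let $M$ be a smooth manifold of real dimension $2n$ with a para-complex structure $I$, that is, a smooth field of endomorphisms of $TM$ with $I^2=\mathrm{Id}$, $I\neq\pm\mathrm{Id}$ at each point, whose two eigendistributions $\ker(I\mp\mathrm{Id})$ have the same rank and are integrable. Let $\widehat g$ be a para-holomorphic Riemannian metric on $(M,I)$: a smooth symmetric non-degenerate $C$-bilinear form on $T_CM=TM\otimes_{\mathbb R}C$ such that $\widehat g(\overline{Z_1},\overline{Z_2})=\overline{\widehat g(Z_1,Z_2)}$, such that $T^{1,0}M=\{Z: IZ=eZ\}$ and $T^{0,1}M=\{Z: IZ=-eZ\}$ are $\widehat g$-orthogonal, and whose components $\widehat g_{ab}=\widehat g(\partial/\partial z^a,\partial/\partial z^b)$ in para-holomorphic coordinates $z^a=x^a+ey^a$ are para-holomorphic, $\partial\widehat g_{ab}/\partial\overline{z}^c=0$. For real $X$ put $\widehat X=\frac12(X+eIX)\in T^{1,0}M$, and let $g(X,Y)=2\,\mathrm{Re}\,\widehat g(\widehat X,\widehat Y)$ be the associated real (pseudo-)Riemannian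 metric. Let $\mathrm{Ric}(g)(X,Y)=\mathrm{Tr}\{Z\mapsto R(Z,X)Y\}$ be the Ricci tensor of $g$, where $R(X,Y)=[\nabla_X,\nabla_Y]-\nabla_{[X,Y]}$, and let $Q$ be its Ricci operator, $g(QX,Y)=\mathrm{Ric}(g)(X,Y)$. Let $\mathrm{Ric}(\widehat g)$ be the Ricci tensor on $T^{1,0}M$ obtained in the same way from the Levi-Civita connection of $\widehat g$, that is, by the usual coordinate formulas with $\widehat g_{ab}$ and $\partial/\partial z^a$, the trace being over $C$. Let $\lambda_1,\lambda_2\in\mathbb{R}$ and $\widehat\lambda=\lambda_1+e\lambda_2$. Then $\widehat g$ is Einstein with para-complex constant $\widehat\lambda$, i.e. $\mathrm{Ric}(\widehat g)=\widehat\lambda\,\widehat g$ on $T^{1,0}M$, if and only if $$\mathrm{Ric}(g)(X,Y)=\lambda_1\,g(X,Y)+\lambda_2\,g(X,IY)\quad\text{for all real tangent vectors } X,Y \text{ at all points of } M.$$ In that case, at every point of $M$, $\lambda_1=K/(2n)$ and $\lambda_2=K^*/(2n)$, where $K=\mathrm{Tr}\,Q$ and $K^*=\mathrm{Tr}(IQ)$.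 -/

import Mathlib

open scoped Manifold ContDiff TensorProduct

noncomputable section

namespace ParaHol

/-! ### Para-complex numbers -/

/-- The algebra `C = ℝ + eℝ` of para-complex numbers, `e² = 1`. -/
abbrev ParaComplex : Type := QuadraticAlgebra ℝ 1 0

/-- The para-complex unit `e`. -/
def e : ParaComplex := ⟨0, 1⟩

/-- The para-complex conjugation `x + ey ↦ x - ey`, as a real linear map. -/
def conjC : ParaComplex →ₗ[ℝ] ParaComplex where
  toFun z := ⟨z.re, -z.im⟩
  map_add' z w := by ext <;> simp [add_comm]
  map_smul' r z := by ext <;> simp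

/-- Derivative at `p` in the (real) direction `v` of a para-complex valued function on a real
normed space, computed on real and imaginary parts. -/
def derivC {F : Type*} [NormedAddCommGroup F] [NormedSpace ℝ F]
    (f : F → ParaComplex) (p v : F) : ParaComplex :=
  ⟨fderiv ℝ (fun q => (f q).re) p v, fderiv ℝ (fun q => (f q).im) p v⟩

/-! ### Metric geometry in a coordinate system

The formulas are written once, for functions on a coordinate domain `P` with values in a
commutative `ℝ`-algebra `A`, coordinate derivations `∂ a` and metric components `g p a b`. They are
used with `A = ℝ` and the partial derivatives of real coordinates, and with `A = C` and the
derivations `∂/∂z^a` of para-holomorphic coordinates. -/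

section Local

variable {ι P A : Type*} [Fintype ι] [DecidableEq ι] [CommRing A] [Algebra ℝ A]

/-- Christoffel symbols `Γ^c_{ab} = ½ g^{cd} (∂_a g_{bd} + ∂_b g_{ad} - ∂_d g_{ab})`
of the Levi-Civita connection, `∇_{∂_a} ∂_b = Γ^c_{ab} ∂_c`. -/
def christoffel (D : ι → (P → A) → P → A) (g : P → Matrix ι ι A) (c a b : ι) : P → A := fun p =>
  (1 / 2 : ℝ) • ∑ d, (g p)⁻¹ c d *
    (D a (fun q => g q b d) p + D b (fun q => g q a d) p - D d (fun q => g q a b) p)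

/-- Components `R^d_{c,ab}` of the curvature, `R(∂_a, ∂_b) ∂_c = R^d_{c,ab} ∂_d`, where
`R(X,Y)Z = ∇_X ∇_Y Z - ∇_Y ∇_X Z - ∇_{[X,Y]} Z`. -/
def riemann (D : ι → (P → A) → P → A) (g : P → Matrix ι ι A) (d c a b : ι) : P → A := fun p =>
  D a (christoffel D g d c b) p - D b (christoffel D g d c a) p +
    ∑ f, (christoffel D g f c b p * christoffel D g d f a p -
      christoffel D g f c a p * christoffel D g d f b p)

/-- Components `Ric(∂_a, ∂_c) = Tr (Z ↦ R(Z, ∂_a) ∂_c)` of the Ricci tensor. -/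
def ricci (D : ι → (P → A) → P → A) (g : P → Matrix ι ι A) (a c : ι) : P → A := fun p =>
  ∑ b, riemann D g b c b a p

end Local

/-! ### Para-complex manifolds -/

/-- The model space of a real `2n`-dimensional manifold. -/
abbrev RModel (n : ℕ) : Type := EuclideanSpace ℝ (Fin (2 * n))

/-- `Cⁿ`, with the point `z = x + ey` written as the pair `(x, y)` of vectors of `ℝⁿ`. -/
abbrev CModel (n : ℕ) : Type := (Fin n → ℝ) × (Fin n → ℝ)

/-- Tangent spaces of a smooth manifold of real dimension `2n`. -/
abbrev T (n : ℕ) {M : Type*} [TopologicalSpace M] [ChartedSpace (RModel n) M] (x : M) : Type :=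
  TangentSpace (𝓡 (2 * n)) x

/-- The para-complexified tangent space `T_x M ⊗ C`. -/
abbrev TC (n : ℕ) {M : Type*} [TopologicalSpace M] [ChartedSpace (RModel n) M] (x : M) : Type :=
  ParaComplex ⊗[ℝ] (T n x)

section

variable {n : ℕ} {M : Type*} [TopologicalSpace M] [ChartedSpace (RModel n) M]

/-- A distribution is integrable if every point has a smooth chart, defined around it, in which the
distribution is a constant linear subspace of the model space. -/
def IsIntegrable [IsManifold (𝓡 (2 * n)) ∞ M] (D : ∀ x : M, Submodule ℝ (T n x)) : Prop :=
  ∀ x : M, ∃ φ ∈ IsManifold.maximalAtlas (𝓡 (2 * n)) ∞ M, x ∈ φ.source ∧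
    ∃ W : Submodule ℝ (RModel n), ∀ y ∈ φ.source, ∀ v : T n y,
      v ∈ D y ↔ mfderiv (𝓡 (2 * n)) (𝓡 (2 * n)) φ y v ∈ W

variable (n M) in
/-- A para-complex structure on a smooth manifold of real dimension `2n`. -/
structure ParaComplexStructure [IsManifold (𝓡 (2 * n)) ∞ M] where
  /-- the endomorphism `I` of the tangent bundle -/
  I : ∀ x : M, T n x →L[ℝ] T n x
  smooth : ContMDiff (𝓡 (2 * n)) ((𝓡 (2 * n)).prod 𝓘(ℝ, RModel n →L[ℝ] RModel n)) ∞
    (fun x => (⟨x, I x⟩ : Bundle.TotalSpace (RModel n →L[ℝ] RModel n)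
      (fun x : M => T n x →L[ℝ] T n x)))
  sq : ∀ x v, I x (I x v) = v
  ne_id : ∀ x, I x ≠ ContinuousLinearMap.id ℝ (T n x)
  ne_neg_id : ∀ x, I x ≠ -ContinuousLinearMap.id ℝ (T n x)
  finrank_eq : ∀ x, Module.finrank ℝ (Module.End.eigenspace (I x).toLinearMap 1) =
    Module.finrank ℝ (Module.End.eigenspace (I x).toLinearMap (-1))
  integrable_plus : IsIntegrable (fun x : M => Module.End.eigenspace (I x).toLinearMap 1)
  integrable_minus : IsIntegrable (fun x : M => Module.End.eigenspace (I x).toLinearMap (-1))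

/-- The coordinate vector at the point `φ⁻¹ p` which the coordinate system `φ` maps to `v`. -/
def coordVec {F : Type*} [NormedAddCommGroup F] [NormedSpace ℝ F]
    (φ : OpenPartialHomeomorph M F) (p v : F) : T n (φ.symm p) :=
  mfderiv 𝓘(ℝ, F) (𝓡 (2 * n)) φ.symm p v

/-- Conjugation on `T_x M ⊗ C`. -/
def conjT (x : M) : TC n x →ₗ[ℝ] TC n x :=
  LinearMap.rTensor (T n x) conjC

section Structure

variable [IsManifold (𝓡 (2 * n)) ∞ M] (J : ParaComplexStructure n M)

/-- The `C`-linear extension of `I` to `T_x M ⊗ C`. -/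
def IC (x : M) : TC n x →ₗ[ParaComplex] TC n x :=
  (J.I x).toLinearMap.baseChange ParaComplex

/-- `T^{1,0}_x M`. -/
def T10 (x : M) : Submodule ParaComplex (TC n x) :=
  Module.End.eigenspace (IC J x) e

/-- `T^{0,1}_x M`. -/
def T01 (x : M) : Submodule ParaComplex (TC n x) :=
  Module.End.eigenspace (IC J x) (-e)

/-- `X̂ = ½ (X + e I X)` for a real tangent vector `X`. -/
def hat (x : M) : T n x →ₗ[ℝ] TC n x :=
  (1 / 2 : ℝ) • (TensorProduct.mk ℝ ParaComplex (T n x) 1 +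
    (TensorProduct.mk ℝ ParaComplex (T n x) e).comp (J.I x).toLinearMap)

/-- Para-holomorphic coordinate systems `z = x + ey`: diffeomorphisms `φ` between open subsets of
`M` and of `Cⁿ` with `dφ (I v) = e · dφ v`, multiplication by `e` on `Cⁿ` being
`(x, y) ↦ (y, x)`. -/
structure IsParaHolChart (φ : OpenPartialHomeomorph M (CModel n)) : Prop where
  smooth : ContMDiffOn (𝓡 (2 * n)) 𝓘(ℝ, CModel n) ∞ φ φ.source
  smooth_symm : ContMDiffOn 𝓘(ℝ, CModel n) (𝓡 (2 * n)) ∞ φ.symm φ.target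
  comm : ∀ x ∈ φ.source, ∀ v : T n x,
    (mfderiv (𝓡 (2 * n)) 𝓘(ℝ, CModel n) φ x (J.I x v) : CModel n) =
      Prod.swap (mfderiv (𝓡 (2 * n)) 𝓘(ℝ, CModel n) φ x v : CModel n)

end Structure

/-- The real directions `∂/∂x^a` of `Cⁿ`. -/
def dirX (a : Fin n) : CModel n := (Pi.single a 1, 0)

/-- The real directions `∂/∂y^a` of `Cⁿ`. -/
def dirY (a : Fin n) : CModel n := (0, Pi.single a 1)

/-- `∂f/∂z^a = ½ (∂f/∂x^a + e ∂f/∂y^a)`. -/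
def dz (a : Fin n) (f : CModel n → ParaComplex) (p : CModel n) : ParaComplex :=
  (1 / 2 : ℝ) • (derivC f p (dirX a) + e * derivC f p (dirY a))

/-- `∂f/∂z̄^a = ½ (∂f/∂x^a - e ∂f/∂y^a)`. -/
def dzbar (a : Fin n) (f : CModel n → ParaComplex) (p : CModel n) : ParaComplex :=
  (1 / 2 : ℝ) • (derivC f p (dirX a) - e * derivC f p (dirY a))

/-- The coordinate vectors `∂/∂z^a = ½ (∂/∂x^a + e ∂/∂y^a)` of the coordinate system `φ`. -/
def frame (φ : OpenPartialHomeomorph M (CModel n)) (p : CModel n) (a : Fin n) :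
    TC n (φ.symm p) :=
  (1 / 2 : ℝ) • ((1 : ParaComplex) ⊗ₜ[ℝ] coordVec φ p (dirX a) +
    e ⊗ₜ[ℝ] coordVec φ p (dirY a))

/-! ### Para-holomorphic Riemannian metrics -/

/-- A para-complex Riemannian metric: a smooth symmetric non-degenerate `C`-bilinear form `G` on
`TM ⊗ C` with `G(Z̄₁, Z̄₂)` the conjugate of `G(Z₁, Z₂)`, for which `T^{1,0}` and `T^{0,1}` are
orthogonal. -/
structure ParaComplexMetric [IsManifold (𝓡 (2 * n)) ∞ M] (J : ParaComplexStructure n M) where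
  /-- the bilinear form at each point -/
  form : ∀ x : M, LinearMap.BilinForm ParaComplex (TC n x)
  symm : ∀ x Z₁ Z₂, form x Z₁ Z₂ = form x Z₂ Z₁
  nondegenerate : ∀ x, (form x).Nondegenerate
  conj : ∀ x Z₁ Z₂, form x (conjT x Z₁) (conjT x Z₂) = conjC (form x Z₁ Z₂)
  orthogonal : ∀ x, ∀ Z₁ ∈ T10 J x, ∀ Z₂ ∈ T01 J x, form x Z₁ Z₂ = 0
  smooth_re : ∀ φ ∈ IsManifold.maximalAtlas (𝓡 (2 * n)) ∞ M, ∀ v w : RModel n,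
    ContDiffOn ℝ ∞ (fun p => (form (φ.symm p) ((1 : ParaComplex) ⊗ₜ[ℝ] coordVec φ p v)
      ((1 : ParaComplex) ⊗ₜ[ℝ] coordVec φ p w)).re) φ.target
  smooth_im : ∀ φ ∈ IsManifold.maximalAtlas (𝓡 (2 * n)) ∞ M, ∀ v w : RModel n,
    ContDiffOn ℝ ∞ (fun p => (form (φ.symm p) ((1 : ParaComplex) ⊗ₜ[ℝ] coordVec φ p v)
      ((1 : ParaComplex) ⊗ₜ[ℝ] coordVec φ p w)).im) φ.target

namespace ParaComplexMetric

variable [IsManifold (𝓡 (2 * n)) ∞ M] {J : ParaComplexStructure n M} (G : ParaComplexMetric J)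

/-- The components `G_{ab} = G(∂/∂z^a, ∂/∂z^b)` in a coordinate system, as functions of `z`. -/
def components (φ : OpenPartialHomeomorph M (CModel n)) (p : CModel n) :
    Matrix (Fin n) (Fin n) ParaComplex :=
  Matrix.of fun a b => G.form (φ.symm p) (frame φ p a) (frame φ p b)

/-- `G` is para-holomorphic: its components in para-holomorphic coordinates are para-holomorphic
functions. -/
def IsParaHolomorphic : Prop :=
  ∀ φ : OpenPartialHomeomorph M (CModel n), IsParaHolChart J φ → ∀ p ∈ φ.target,
    ∀ a b c : Fin n, dzbar c (fun q => G.components φ q a b) p = 0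

/-- `G` is Einstein with para-complex constant `l`: `Ric(G) = l G` on `T^{1,0} M`, where `Ric(G)` is
the Ricci tensor of the Levi-Civita connection of `G` on `T^{1,0} M`. -/
def IsEinstein (l : ParaComplex) : Prop :=
  ∀ φ : OpenPartialHomeomorph M (CModel n), IsParaHolChart J φ → ∀ p ∈ φ.target,
    ∀ a b : Fin n, ricci dz (G.components φ) a b p = l * G.components φ p a b

/-- The real metric `g(X, Y) = 2 Re G(X̂, Ŷ)`. -/
def real (x : M) : LinearMap.BilinForm ℝ (T n x) :=
  LinearMap.mk₂ ℝ (fun X Y => 2 * (G.form x (hat J x X) (hat J x Y)).re)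
    (fun _ _ _ => by simp [mul_add]) (fun r X Y => by
      rw [map_smul, ← algebraMap_smul ParaComplex r (hat J x X), map_smul, LinearMap.smul_apply,
        algebraMap_smul]
      simp; ring)
    (fun _ _ _ => by simp [mul_add]) (fun r X Y => by
      rw [map_smul, ← algebraMap_smul ParaComplex r (hat J x Y), map_smul, algebraMap_smul]
      simp; ring)

/-- The components `g_{ij}` of the real metric in a smooth chart of `M`. -/
def realComponents (φ : OpenPartialHomeomorph M (RModel n)) (p : RModel n) :
    Matrix (Fin (2 * n)) (Fin (2 * n)) ℝ :=
  Matrix.of fun i j => G.real (φ.symm p) (coordVec φ p (EuclideanSpace.single i 1))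
    (coordVec φ p (EuclideanSpace.single j 1))

/-- The partial derivatives `∂/∂x^i` in real coordinates. -/
def partialR (i : Fin (2 * n)) (f : RModel n → ℝ) (p : RModel n) : ℝ :=
  fderiv ℝ f p (EuclideanSpace.single i 1)

/-- The Ricci tensor `Ric(g)` of the real metric at the point `x`, from its components in the
preferred smooth chart at `x`. -/
def realRicci (x : M) : LinearMap.BilinForm ℝ (T n x) :=
  (Matrix.toBilin (EuclideanSpace.basisFun (Fin (2 * n)) ℝ).toBasis
    (Matrix.of fun i j => ricci partialR (G.realComponents (chartAt (RModel n) x)) i j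
      (chartAt (RModel n) x x))).comp
    (mfderiv (𝓡 (2 * n)) (𝓡 (2 * n)) (chartAt (RModel n) x) x).toLinearMap
    (mfderiv (𝓡 (2 * n)) (𝓡 (2 * n)) (chartAt (RModel n) x) x).toLinearMap

theorem real_apply (x : M) (X Y : T n x) :
    G.real x X Y = 2 * (G.form x (hat J x X) (hat J x Y)).re := rfl

theorem real_symm (x : M) (X Y : T n x) : G.real x X Y = G.real x Y X := by
  rw [real_apply, real_apply, G.symm]

theorem real_nondegenerate (x : M) : (G.real x).Nondegenerate := by
  have hee : e * e = 1 := by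
    ext
    · simp [e]; rfl
    · simp [e]; rfl
  have he1 : ∀ v : T n x, e • ((1 : ParaComplex) ⊗ₜ[ℝ] v) = e ⊗ₜ[ℝ] v := fun v => by
    rw [TensorProduct.smul_tmul', smul_eq_mul, mul_one]
  have he2 : ∀ v : T n x, e • (e ⊗ₜ[ℝ] v) = (1 : ParaComplex) ⊗ₜ[ℝ] v := fun v => by
    rw [TensorProduct.smul_tmul', smul_eq_mul, hee]
  have hmem10 : ∀ X : T n x, hat J x X ∈ T10 J x := by
    intro X
    rw [T10, Module.End.mem_eigenspace_iff]
    simp only [hat, IC, LinearMap.smul_apply, LinearMap.add_apply, TensorProduct.mk_apply,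
      LinearMap.comp_apply, LinearMap.map_smul_of_tower, map_add, LinearMap.baseChange_tmul,
      ContinuousLinearMap.coe_coe, J.sq]
    rw [smul_comm e, smul_add e, he1, he2, add_comm]
  have key : ∀ X : T n x, (∀ Y, G.real x X Y = 0) → X = 0 := by
    intro X hX
    have hre : ∀ Y, (G.form x (hat J x X) (hat J x Y)).re = 0 := by
      intro Y
      have := hX Y
      rw [real_apply] at this
      linarith
    have hI : ∀ Y, hat J x (J.I x Y) = e • hat J x Y := by
      intro Y
      simp only [hat, LinearMap.smul_apply, LinearMap.add_apply, TensorProduct.mk_apply,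
        LinearMap.comp_apply, ContinuousLinearMap.coe_coe, J.sq]
      rw [smul_comm e, smul_add e, he1, he2, add_comm]
    have h0 : ∀ Y, G.form x (hat J x X) (hat J x Y) = 0 := by
      intro Y
      ext
      · exact hre Y
      · have := hre (J.I x Y)
        rw [hI, map_smul, smul_eq_mul] at this
        simpa [e] using this
    have h1 : ∀ Y : T n x, G.form x (hat J x X) ((1 : ParaComplex) ⊗ₜ[ℝ] Y) = 0 := by
      intro Y
      have hm : (1 : ParaComplex) ⊗ₜ[ℝ] Y - hat J x Y ∈ T01 J x := by
        have hs : (1 : ParaComplex) ⊗ₜ[ℝ] Y - hat J x Y =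
            (1 / 2 : ℝ) • ((1 : ParaComplex) ⊗ₜ[ℝ] Y - e ⊗ₜ[ℝ] J.I x Y) := by
          simp only [hat, LinearMap.smul_apply, LinearMap.add_apply, TensorProduct.mk_apply,
            LinearMap.comp_apply, ContinuousLinearMap.coe_coe]
          module
        rw [hs, T01, Module.End.mem_eigenspace_iff]
        simp only [IC, LinearMap.map_smul_of_tower, map_sub, LinearMap.baseChange_tmul,
          ContinuousLinearMap.coe_coe, J.sq]
        rw [smul_comm (-e), neg_smul, smul_sub e, he1, he2, neg_sub]
      have := G.orthogonal x _ (hmem10 X) _ hm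
      rwa [map_sub, h0, sub_zero] at this
    have h2 : ∀ Z, G.form x (hat J x X) Z = 0 := by
      intro Z
      induction Z using TensorProduct.induction_on with
      | zero => simp
      | add a b ha hb => rw [map_add, ha, hb, add_zero]
      | tmul c Y =>
        have : c ⊗ₜ[ℝ] Y = c • ((1 : ParaComplex) ⊗ₜ[ℝ] Y) := by
          rw [TensorProduct.smul_tmul', smul_eq_mul, mul_one]
        rw [this, map_smul, h1, smul_zero]
    have h3 : hat J x X = 0 := (G.nondegenerate x).1 _ h2
    have h4 := congrArg (fun Z => TensorProduct.lid ℝ (T n x)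
      (LinearMap.rTensor (T n x) (QuadraticAlgebra.reₗ (R := ℝ) 1 0) Z)) h3
    have h5 : (1 : ParaComplex).re = 1 := rfl
    simpa [hat, e, h5] using h4
  refine ⟨key, fun Y hY => key Y fun X => ?_⟩
  rw [real_symm]
  exact hY X

instance (x : M) : FiniteDimensional ℝ (T n x) :=
  inferInstanceAs (FiniteDimensional ℝ (RModel n))

/-- The Ricci operator `Q`, determined by `g(QX, Y) = Ric(g)(X, Y)`. -/
def ricciOperator (x : M) : T n x →ₗ[ℝ] T n x :=
  LinearMap.BilinForm.symmCompOfNondegenerate (G.realRicci x) (G.real x) (G.real_nondegenerate x)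

/-- The scalar curvature `K = Tr Q`. -/
def scalarK (x : M) : ℝ := LinearMap.trace ℝ (T n x) (G.ricciOperator x)

/-- The scalar curvature `K* = Tr (I Q)`. -/
def scalarKstar (x : M) : ℝ :=
  LinearMap.trace ℝ (T n x) ((J.I x).toLinearMap ∘ₗ G.ricciOperator x)

end ParaComplexMetric

end

end ParaHol

end

/-!
The algebra `C` splits as `ℝ × ℝ` through the two ring homomorphisms `proj s : x + ey ↦ x + sy`,
`s = ±1`, and this splits the whole geometry. In para-holomorphic coordinates let
`N_s a = ½ (∂/∂x^a + s ∂/∂y^a)` be the null directions (`nullVec`) and `h_s = proj s Ĝ` the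
projections of the matrix `Ĝ` of components of the metric.

* `∂/∂z^a` projects to the derivative along `N_s a` (`proj_dz`) and `∂/∂z̄^a` to the derivative
  along `N_{-s} a` (`proj_dzbar`). Hence the Ricci tensor of `Ĝ` projects to that of `h_s`
  (`proj_ricci`), and para-holomorphy says that `h_s` does not depend on the null coordinates of the
  opposite sign (`proj_components_mem_constAlong`).
* In the basis of the null directions, the real metric is the block matrix with diagonal blocks
  `h_1` and `h_{-1}` (`metricComponents_nullBasis`). It is thus locally a product metric, and its
  Ricci tensor is block diagonal with the Ricci tensors of `h_1` and `h_{-1}` as blocks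
  (`ricci_fromBlocks`).

So the real Ricci tensor has the blocks `proj s Ric(Ĝ)` (`realRicci_nullBasis`). As `I` acts on
`N_s a` as multiplication by `s`, the form `l₁ g(X, Y) + l₂ g(X, I Y)` has the blocks
`(l₁ + s l₂) h_s = proj s ((l₁ + e l₂) Ĝ)`, and the two Einstein equations are equivalent at each
point (`einstein_iff_at`).

The real Ricci tensor is defined through the preferred chart at a point, so its comparison with null
coordinates rests on coordinate invariance (`IsPullbackAt.ricci_eq`), which follows from the
transformation laws of the Levi-Civita connection and of the curvature under a local diffeomorphism.
The Einstein condition for `Ĝ` speaks of para-holomorphic charts only; that there is one around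
every point (`exists_isParaHolChart`) follows from the integrability of both eigendistributions and
the inverse function theorem. Finally, the real Einstein equation says `Q = l₁ Id + l₂ I`, and
`Tr I = 0` gives the formulas for `l₁` and `l₂`.
-/

set_option linter.unusedSectionVars false

noncomputable section

namespace ParaHol

open Filter Topology Module

/-! ### Smooth functions that are constant along given directions -/

section Calculus

variable {E : Type*} [NormedAddCommGroup E] [NormedSpace ℝ E]

theorem eventually_differentiableAt {F : Type*} [NormedAddCommGroup F] [NormedSpace ℝ F]
    {f : E → F} {p : E} (hf : ContDiffAt ℝ ∞ f p) : ∀ᶠ q in 𝓝 p, DifferentiableAt ℝ f q := by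
  have h1 : ContDiffAt ℝ 1 f p := contDiffAt_infty.1 hf 1
  filter_upwards [h1.eventually (by simp)] with q hq using hq.differentiableAt (by simp)

theorem eventually_isSymmSndFDerivAt {F : Type*} [NormedAddCommGroup F] [NormedSpace ℝ F]
    {f : E → F} {p : E} (hf : ContDiffAt ℝ ∞ f p) : ∀ᶠ q in 𝓝 p, IsSymmSndFDerivAt ℝ f q := by
  have h1 : ContDiffAt ℝ 2 f p := contDiffAt_infty.1 hf 2
  filter_upwards [h1.eventually (by simp)] with q hq using hq.isSymmSndFDerivAt (by simp)

theorem contDiffAt_fderiv {F : Type*} [NormedAddCommGroup F] [NormedSpace ℝ F]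
    {f : E → F} {p : E} (hf : ContDiffAt ℝ ∞ f p) : ContDiffAt ℝ ∞ (fderiv ℝ f) p :=
  hf.fderiv_right (by simp)

/-- The functions which are smooth at `p` and, near `p`, have zero derivative in the directions
of `V`. For empty `V` these are just the functions smooth at `p`. -/
def constAlong (V : Set E) (p : E) : Subalgebra ℝ (E → ℝ) where
  carrier := {f | ContDiffAt ℝ ∞ f p ∧ ∀ᶠ q in 𝓝 p, ∀ v ∈ V, fderiv ℝ f q v = 0}
  mul_mem' := by
    rintro f g ⟨hf, hf'⟩ ⟨hg, hg'⟩
    refine ⟨hf.mul hg, ?_⟩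
    filter_upwards [hf', hg', eventually_differentiableAt hf, eventually_differentiableAt hg]
      with q h1 h2 h3 h4 v hv
    rw [fderiv_mul h3 h4]
    simp [h1 v hv, h2 v hv]
  add_mem' := by
    rintro f g ⟨hf, hf'⟩ ⟨hg, hg'⟩
    refine ⟨hf.add hg, ?_⟩
    filter_upwards [hf', hg', eventually_differentiableAt hf, eventually_differentiableAt hg]
      with q h1 h2 h3 h4 v hv
    rw [fderiv_add h3 h4]
    simp [h1 v hv, h2 v hv]
  algebraMap_mem' r := by
    refine ⟨contDiffAt_const (c := r), Eventually.of_forall fun q v _ => ?_⟩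
    have : (algebraMap ℝ (E → ℝ) r) = fun _ => r := rfl
    simp [this]

theorem mem_constAlong {V : Set E} {p : E} {f : E → ℝ} :
    f ∈ constAlong V p ↔
      ContDiffAt ℝ ∞ f p ∧ ∀ᶠ q in 𝓝 p, ∀ v ∈ V, fderiv ℝ f q v = 0 := Iff.rfl

theorem mem_constAlong_empty {p : E} {f : E → ℝ} :
    f ∈ constAlong ∅ p ↔ ContDiffAt ℝ ∞ f p := by
  simp [mem_constAlong]

/-- Constancy along `V` is inherited by derivatives in arbitrary fixed directions, as second
derivatives are symmetric. -/
theorem fderiv_apply_mem_constAlong {V : Set E} {p : E} {f : E → ℝ} (hf : f ∈ constAlong V p)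
    (w : E) : (fun q => fderiv ℝ f q w) ∈ constAlong V p := by
  refine ⟨(contDiffAt_fderiv hf.1).clm_apply contDiffAt_const, ?_⟩
  filter_upwards [eventually_isSymmSndFDerivAt hf.1, hf.2.eventually_nhds,
    eventually_differentiableAt (contDiffAt_fderiv hf.1)] with q h1 h2 h3 v hv
  have h4 : (fun y => fderiv ℝ f y v) =ᶠ[𝓝 q] fun _ => (0 : ℝ) := h2.mono fun y hy => hy v hv
  have h5 := h4.fderiv_eq (𝕜 := ℝ)
  have h6 (u : E) : fderiv ℝ (fun y => fderiv ℝ f y u) q = (fderiv ℝ (fderiv ℝ f) q).flip u := by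
    rw [fderiv_clm_apply h3 (differentiableAt_const u)]
    simp
  rw [h6, ContinuousLinearMap.flip_apply, h1.eq, ← ContinuousLinearMap.flip_apply, ← h6, h5]
  simp

theorem inv_mem_constAlong {V : Set E} {p : E} {f : E → ℝ} (hf : f ∈ constAlong V p)
    (h0 : f p ≠ 0) : (fun q => (f q)⁻¹) ∈ constAlong V p := by
  refine ⟨hf.1.inv h0, ?_⟩
  filter_upwards [hf.2, eventually_differentiableAt hf.1, hf.1.continuousAt.eventually_ne h0]
    with q h1 h2 h3 v hv
  have h4 : HasFDerivAt (fun q => (f q)⁻¹) _ q :=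
    HasDerivAt.comp_hasFDerivAt (h₂ := fun y : ℝ => y⁻¹) q (hasDerivAt_inv h3) h2.hasFDerivAt
  rw [h4.fderiv]
  simp [h1 v hv]

variable {ι : Type*} [Fintype ι] [DecidableEq ι]

theorem det_mem_constAlong {V : Set E} {p : E} {g : E → Matrix ι ι ℝ}
    (hg : ∀ i j, (fun q => g q i j) ∈ constAlong V p) : (fun q => (g q).det) ∈ constAlong V p := by
  have : (fun q => (g q).det) =
      ∑ σ : Equiv.Perm ι, ((Equiv.Perm.sign σ : ℤ) : ℝ) • ∏ i, fun q => g q (σ i) i := by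
    ext q
    simp [Matrix.det_apply', Finset.sum_apply, Finset.prod_apply]
  rw [this]
  exact Subalgebra.sum_mem _ fun σ _ => Subalgebra.smul_mem _
    (Subalgebra.prod_mem _ fun i _ => hg _ _) _

theorem inv_apply_mem_constAlong {V : Set E} {p : E} {g : E → Matrix ι ι ℝ}
    (hg : ∀ i j, (fun q => g q i j) ∈ constAlong V p) (h0 : (g p).det ≠ 0) (i j : ι) :
    (fun q => (g q)⁻¹ i j) ∈ constAlong V p := by
  have h1 : (fun q => (g q)⁻¹ i j) =
      (fun q => ((g q).det)⁻¹) * fun q => ((g q).updateRow j (Pi.single i 1)).det := by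
    ext q
    simp [Matrix.inv_def, Ring.inverse_eq_inv', Matrix.adjugate_apply]
  rw [h1]
  refine Subalgebra.mul_mem _ (inv_mem_constAlong (det_mem_constAlong hg) h0)
    (det_mem_constAlong fun k l => ?_)
  by_cases hk : k = j
  · subst hk
    simp only [Matrix.updateRow_self]
    exact Subalgebra.algebraMap_mem (constAlong V p) ((Pi.single i 1 : ι → ℝ) l)
  · simpa [Matrix.updateRow_ne hk] using hg k l

/-- The coordinate derivations on real functions given by vectors `w i`. -/
def dirDeriv (w : ι → E) (i : ι) (f : E → ℝ) (p : E) : ℝ := fderiv ℝ f p (w i)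

/-- If a metric does not depend on the coordinates along `V`, neither do its Christoffel symbols.
With empty `V` this is their smoothness. -/
theorem christoffel_mem_constAlong {V : Set E} {p : E} {g : E → Matrix ι ι ℝ} (w : ι → E)
    (hg : ∀ i j, (fun q => g q i j) ∈ constAlong V p) (h0 : (g p).det ≠ 0) (c a b : ι) :
    christoffel (dirDeriv w) g c a b ∈ constAlong V p := by
  have : christoffel (dirDeriv w) g c a b = (1 / 2 : ℝ) • ∑ d, (fun q => (g q)⁻¹ c d) *
      ((fun q => fderiv ℝ (fun q => g q b d) q (w a)) +
        (fun q => fderiv ℝ (fun q => g q a d) q (w b)) -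
        (fun q => fderiv ℝ (fun q => g q a b) q (w d))) := by
    ext q
    simp [christoffel, dirDeriv, Finset.sum_apply]
  rw [this]
  have hd (i j k : ι) := fderiv_apply_mem_constAlong (hg i j) (w k)
  exact Subalgebra.smul_mem _ (Subalgebra.sum_mem _ fun d _ => Subalgebra.mul_mem _
    (inv_apply_mem_constAlong hg h0 c d) (Subalgebra.sub_mem _
      (Subalgebra.add_mem _ (hd _ _ _) (hd _ _ _)) (hd _ _ _))) _

end Calculus

/-! ### Levi-Civita connection and Ricci tensor on an open set of a vector space -/

section CoordinateFree

variable {E : Type*} [NormedAddCommGroup E] [NormedSpace ℝ E]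

/-- `Γ` represents at `q` the Levi-Civita connection of `B`: the Koszul formula holds for constant
vector fields. -/
def IsLeviCivitaAt (B : E → E →L[ℝ] E →L[ℝ] ℝ) (Γ : E → E →L[ℝ] E →L[ℝ] E) (q : E) : Prop :=
  ∀ u v w, B q (Γ q u v) w =
    1 / 2 * (fderiv ℝ B q u v w + fderiv ℝ B q v u w - fderiv ℝ B q w u v)

/-- `x ↦ R(x, u) v` for the connection `∇_u v = Γ(v, u)`, on constant vector fields. -/
def curvature (Γ : E → E →L[ℝ] E →L[ℝ] E) (p u v : E) : E →ₗ[ℝ] E where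
  toFun x := fderiv ℝ Γ p x v u - fderiv ℝ Γ p u v x + Γ p (Γ p v u) x - Γ p (Γ p v x) u
  map_add' x y := by simp; abel
  map_smul' r x := by simp [smul_sub, smul_add]

theorem curvature_apply (Γ : E → E →L[ℝ] E →L[ℝ] E) (p u v x : E) : curvature Γ p u v x =
    fderiv ℝ Γ p x v u - fderiv ℝ Γ p u v x + Γ p (Γ p v u) x - Γ p (Γ p v x) u := rfl

/-- `Ric(u, v) = Tr (x ↦ R(x, u) v)`. -/
def ricciForm (Γ : E → E →L[ℝ] E →L[ℝ] E) (p : E) : LinearMap.BilinForm ℝ E :=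
  LinearMap.mk₂ ℝ (fun u v => LinearMap.trace ℝ E (curvature Γ p u v))
    (fun u u' v => by
      rw [← map_add]; congr 1; ext x; simp [curvature_apply]; abel)
    (fun r u v => by
      rw [← map_smul]; congr 1; ext x; simp [curvature_apply, smul_sub, smul_add])
    (fun u v v' => by
      rw [← map_add]; congr 1; ext x; simp [curvature_apply]; abel)
    (fun r u v => by
      rw [← map_smul]; congr 1; ext x; simp [curvature_apply, smul_sub, smul_add])

theorem ricciForm_apply (Γ : E → E →L[ℝ] E →L[ℝ] E) (p u v : E) :
    ricciForm Γ p u v = LinearMap.trace ℝ E (curvature Γ p u v) := rfl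

variable {F : Type*} [NormedAddCommGroup F] [NormedSpace ℝ F]

/-- Transformation law of the Levi-Civita connection under a change of coordinates `ψ`. -/
theorem IsLeviCivitaAt.transform {ψ : F → E} {q : F} {B : E → E →L[ℝ] E →L[ℝ] ℝ}
    {B' : F → F →L[ℝ] F →L[ℝ] ℝ} {Γ : E → E →L[ℝ] E →L[ℝ] E} {Γ' : F → F →L[ℝ] F →L[ℝ] F}
    (hΓ : IsLeviCivitaAt B Γ (ψ q)) (hΓ' : IsLeviCivitaAt B' Γ' q)
    (hB : DifferentiableAt ℝ B (ψ q)) (hB' : DifferentiableAt ℝ B' q)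
    (hψ : DifferentiableAt ℝ ψ q) (hψ2 : DifferentiableAt ℝ (fderiv ℝ ψ) q)
    (hsymm : IsSymmSndFDerivAt ℝ ψ q) (hsurj : Function.Surjective (fderiv ℝ ψ q))
    (hBs : ∀ u v, B (ψ q) u v = B (ψ q) v u)
    (hBn : ∀ u, (∀ v, B (ψ q) u v = 0) → u = 0)
    (hpull : ∀ᶠ y in 𝓝 q, ∀ u v, B' y u v = B (ψ y) (fderiv ℝ ψ y u) (fderiv ℝ ψ y v))
    (u v : F) : fderiv ℝ ψ q (Γ' q u v) =
      fderiv ℝ (fderiv ℝ ψ) q v u + Γ (ψ q) (fderiv ℝ ψ q u) (fderiv ℝ ψ q v) := by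
  -- The product rule for `B' = B(ψ)(dψ, dψ)`.
  have hd (x u v : F) : fderiv ℝ B' q x u v =
      fderiv ℝ B (ψ q) (fderiv ℝ ψ q x) (fderiv ℝ ψ q u) (fderiv ℝ ψ q v) +
      B (ψ q) (fderiv ℝ (fderiv ℝ ψ) q x u) (fderiv ℝ ψ q v) +
      B (ψ q) (fderiv ℝ ψ q u) (fderiv ℝ (fderiv ℝ ψ) q x v) := by
    have hl : HasFDerivAt (fun y => B' y u v) _ q :=
      (hB'.hasFDerivAt.clm_apply (hasFDerivAt_const u q)).clm_apply (hasFDerivAt_const v q)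
    have hr : HasFDerivAt (fun y => B (ψ y) (fderiv ℝ ψ y u) (fderiv ℝ ψ y v)) _ q :=
      (((hB.hasFDerivAt.comp q hψ.hasFDerivAt).clm_apply
        (hψ2.hasFDerivAt.clm_apply (hasFDerivAt_const u q))).clm_apply
        (hψ2.hasFDerivAt.clm_apply (hasFDerivAt_const v q)))
    have he : (fun y => B' y u v) =ᶠ[𝓝 q]
        fun y => B (ψ y) (fderiv ℝ ψ y u) (fderiv ℝ ψ y v) := hpull.mono fun y hy => hy u v
    have := congrArg (fun L => L x) (hl.unique (hr.congr_of_eventuallyEq he))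
    simp at this
    rw [this]
    ring
  rw [← sub_eq_zero]
  refine hBn _ fun w => ?_
  obtain ⟨w, rfl⟩ := hsurj w
  have h1 := hΓ' u v w
  rw [hpull.self_of_nhds, hd, hd, hd] at h1
  have h2 := hΓ (fderiv ℝ ψ q u) (fderiv ℝ ψ q v) (fderiv ℝ ψ q w)
  simp only [map_sub, map_add, sub_apply, add_apply]
  rw [h1, h2, hsymm.eq w u, hsymm.eq w v, hsymm.eq u v,
    hBs (fderiv ℝ ψ q u) (fderiv ℝ (fderiv ℝ ψ) q v w),
    hBs (fderiv ℝ ψ q v) (fderiv ℝ (fderiv ℝ ψ) q u w)]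
  ring

/-- Transformation law of the curvature: a connection with the transformation law `h`, whose
inhomogeneous term is symmetric, has a tensorial curvature. -/
theorem curvature_transform {ψ : F → E} {p : F} {Γ : E → E →L[ℝ] E →L[ℝ] E}
    {Γ' : F → F →L[ℝ] F →L[ℝ] F} (hψ : ContDiffAt ℝ ∞ ψ p)
    (hΓ : DifferentiableAt ℝ Γ (ψ p)) (hΓ' : DifferentiableAt ℝ Γ' p)
    (h : ∀ᶠ q in 𝓝 p, ∀ u v, fderiv ℝ ψ q (Γ' q u v) =
      fderiv ℝ (fderiv ℝ ψ) q v u + Γ (ψ q) (fderiv ℝ ψ q u) (fderiv ℝ ψ q v)) (u v x : F) :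
    fderiv ℝ ψ p (curvature Γ' p u v x) =
      curvature Γ (ψ p) (fderiv ℝ ψ p u) (fderiv ℝ ψ p v) (fderiv ℝ ψ p x) := by
  have hψ1 := (hψ.differentiableAt (by simp)).hasFDerivAt
  have hψ2 := ((contDiffAt_fderiv hψ).differentiableAt (by simp)).hasFDerivAt
  have hψ3 := ((contDiffAt_fderiv (contDiffAt_fderiv hψ)).differentiableAt (by simp)).hasFDerivAt
  have hs2 := (eventually_isSymmSndFDerivAt hψ).self_of_nhds
  have hs3 := (eventually_isSymmSndFDerivAt (contDiffAt_fderiv hψ)).self_of_nhds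
  -- The derivative of the transformation law `h` in the direction `x`.
  have hd (x u v : F) : fderiv ℝ ψ p (fderiv ℝ Γ' p x u v) =
      fderiv ℝ (fderiv ℝ (fderiv ℝ ψ)) p x v u +
      fderiv ℝ Γ (ψ p) (fderiv ℝ ψ p x) (fderiv ℝ ψ p u) (fderiv ℝ ψ p v) +
      Γ (ψ p) (fderiv ℝ (fderiv ℝ ψ) p x u) (fderiv ℝ ψ p v) +
      Γ (ψ p) (fderiv ℝ ψ p u) (fderiv ℝ (fderiv ℝ ψ) p x v) -
      fderiv ℝ (fderiv ℝ ψ) p x (Γ' p u v) := by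
    have hl : HasFDerivAt (fun q => fderiv ℝ ψ q (Γ' q u v)) _ p :=
      hψ2.clm_apply ((hΓ'.hasFDerivAt.clm_apply (hasFDerivAt_const u p)).clm_apply
        (hasFDerivAt_const v p))
    have hr1 : HasFDerivAt (fun q => fderiv ℝ (fderiv ℝ ψ) q v u) _ p :=
      (hψ3.clm_apply (hasFDerivAt_const v p)).clm_apply (hasFDerivAt_const u p)
    have hr2 : HasFDerivAt (fun q => Γ (ψ q) (fderiv ℝ ψ q u) (fderiv ℝ ψ q v)) _ p :=
      (((hΓ.hasFDerivAt.comp p hψ1).clm_apply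
        (hψ2.clm_apply (hasFDerivAt_const u p))).clm_apply
        (hψ2.clm_apply (hasFDerivAt_const v p)))
    have he : (fun q => fderiv ℝ ψ q (Γ' q u v)) =ᶠ[𝓝 p] fun q =>
        fderiv ℝ (fderiv ℝ ψ) q v u + Γ (ψ q) (fderiv ℝ ψ q u) (fderiv ℝ ψ q v) :=
      h.mono fun y hy => hy u v
    have := congrArg (fun L => L x) (hl.unique ((hr1.add hr2).congr_of_eventuallyEq he))
    simp at this
    rw [eq_sub_iff_add_eq, this]
    abel
  have h0 := h.self_of_nhds
  simp only [curvature_apply, map_add, map_sub, hd, h0, add_apply]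
  -- The second and third derivatives of `ψ` cancel by symmetry.
  rw [hs3.eq x u, hs2.eq x u, hs2.eq x (Γ' p v u), hs2.eq u (Γ' p v x)]
  abel

theorem ricciForm_transform {ψ : F → E} {p : F} {Γ : E → E →L[ℝ] E →L[ℝ] E}
    {Γ' : F → F →L[ℝ] F →L[ℝ] F} (hψ : ContDiffAt ℝ ∞ ψ p)
    (hbij : Function.Bijective (fderiv ℝ ψ p))
    (hΓ : DifferentiableAt ℝ Γ (ψ p)) (hΓ' : DifferentiableAt ℝ Γ' p)
    (h : ∀ᶠ q in 𝓝 p, ∀ u v, fderiv ℝ ψ q (Γ' q u v) =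
      fderiv ℝ (fderiv ℝ ψ) q v u + Γ (ψ q) (fderiv ℝ ψ q u) (fderiv ℝ ψ q v)) (u v : F) :
    ricciForm Γ' p u v = ricciForm Γ (ψ p) (fderiv ℝ ψ p u) (fderiv ℝ ψ p v) := by
  let L : F ≃ₗ[ℝ] E := LinearEquiv.ofBijective (fderiv ℝ ψ p).toLinearMap hbij
  rw [ricciForm_apply, ricciForm_apply, ← LinearMap.trace_conj' _ L]
  congr 1
  ext y
  obtain ⟨x, rfl⟩ := L.surjective y
  rw [LinearEquiv.conj_apply_apply, L.symm_apply_apply]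
  exact curvature_transform hψ hΓ hΓ' h u v x

end CoordinateFree

/-! ### The index formulas and the invariant Ricci tensor -/

section Bridge

variable {E : Type*} [NormedAddCommGroup E] [NormedSpace ℝ E] [FiniteDimensional ℝ E]
  {ι : Type*} [Fintype ι] [DecidableEq ι]

/-- Induction principle by which multilinear identities are reduced to basis vectors. -/
theorem basis_induction (b : Basis ι ℝ E) {P : E → Prop} (h0 : P 0) (hb : ∀ i, P (b i))
    (hadd : ∀ u v, P u → P v → P (u + v)) (hsmul : ∀ (r : ℝ) u, P u → P (r • u)) (u : E) :
    P u := by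
  have hu : u ∈ Submodule.span ℝ (Set.range b) := by simp [b.span_eq]
  induction hu using Submodule.span_induction with
  | mem x hx => obtain ⟨i, rfl⟩ := hx; exact hb i
  | zero => exact h0
  | add x y _ _ hx hy => exact hadd x y hx hy
  | smul r x _ hx => exact hsmul r x hx

/-- The coordinate functions of a basis, as continuous linear maps. -/
def coordL (b : Basis ι ℝ E) (i : ι) : E →L[ℝ] ℝ := LinearMap.toContinuousLinearMap (b.coord i)

@[simp]
theorem coordL_apply (b : Basis ι ℝ E) (i : ι) (u : E) : coordL b i u = b.repr u i := rfl

/-- The bilinear form with the given components in the basis `b`. -/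
def formOf (b : Basis ι ℝ E) (m : Matrix ι ι ℝ) : E →L[ℝ] E →L[ℝ] ℝ :=
  ∑ i, ∑ j, m i j • (coordL b i).smulRight (coordL b j)

/-- The vector-valued bilinear map with the given components (upper index first) in the basis
`b`. -/
def connOf (b : Basis ι ℝ E) (γ : ι → ι → ι → ℝ) : E →L[ℝ] E →L[ℝ] E :=
  ∑ c, ∑ i, ∑ j, γ c i j • (coordL b i).smulRight ((coordL b j).smulRight (b c))

theorem formOf_apply (b : Basis ι ℝ E) (m : Matrix ι ι ℝ) (u v : E) :
    formOf b m u v = ∑ i, ∑ j, m i j * (b.repr u i * b.repr v j) := by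
  simp [formOf]

@[simp]
theorem formOf_basis (b : Basis ι ℝ E) (m : Matrix ι ι ℝ) (i j : ι) :
    formOf b m (b i) (b j) = m i j := by
  simp [formOf_apply, Finsupp.single_apply]

theorem formOf_symm (b : Basis ι ℝ E) {m : Matrix ι ι ℝ} (h : ∀ i j, m i j = m j i) (u v : E) :
    formOf b m u v = formOf b m v u := by
  rw [formOf_apply, formOf_apply, Finset.sum_comm]
  exact Finset.sum_congr rfl fun i _ => Finset.sum_congr rfl fun j _ => by rw [h]; ring

theorem formOf_nondegenerate (b : Basis ι ℝ E) {m : Matrix ι ι ℝ} (h : m.det ≠ 0) (u : E)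
    (hu : ∀ v, formOf b m u v = 0) : u = 0 := by
  have h1 : Matrix.vecMul (b.repr u) m = 0 := by
    ext j
    have := hu (b j)
    simp only [formOf_apply, b.repr_self, Finsupp.single_apply] at this
    simpa [Matrix.vecMul, dotProduct, mul_comm] using this
  have h2 := Matrix.eq_zero_of_vecMul_eq_zero h h1
  exact b.repr.map_eq_zero_iff.1 (Finsupp.ext fun i => congrFun h2 i)

theorem det_ne_zero_of_formOf_nondegenerate (b : Basis ι ℝ E) {m : Matrix ι ι ℝ}
    (h : ∀ u, (∀ v, formOf b m u v = 0) → u = 0) : m.det ≠ 0 := by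
  intro h0
  obtain ⟨x, hx, hx'⟩ := Matrix.exists_vecMul_eq_zero_iff.2 h0
  have h1 : ∑ i, x i • b i = 0 := by
    refine h _ fun v => ?_
    induction v using basis_induction b with
    | h0 => simp
    | hadd u u' h h' => simp only [map_add, h, h', add_zero]
    | hsmul r u h => simp only [map_smul, h, smul_zero]
    | hb j => simpa [sum_apply, Matrix.vecMul, dotProduct] using congrFun hx' j
  exact hx (funext fun i => Fintype.linearIndependent_iff.1 b.linearIndependent x h1 i)

theorem repr_connOf_basis (b : Basis ι ℝ E) (γ : ι → ι → ι → ℝ) (i j c : ι) :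
    b.repr (connOf b γ (b i) (b j)) c = γ c i j := by
  simp [connOf, Finsupp.single_apply, Finsupp.finsetSum_apply]

theorem connOf_basis (b : Basis ι ℝ E) (γ : ι → ι → ι → ℝ) (i j : ι) :
    connOf b γ (b i) (b j) = ∑ c, γ c i j • b c := by
  rw [← b.sum_repr (connOf b γ (b i) (b j))]
  simp only [repr_connOf_basis]

theorem contDiffAt_smul_const {F G : Type*} [NormedAddCommGroup F] [NormedSpace ℝ F]
    [NormedAddCommGroup G] [NormedSpace ℝ G] {f : F → ℝ} {p : F} (hf : ContDiffAt ℝ ∞ f p) (T : G) :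
    ContDiffAt ℝ ∞ (fun q => f q • T) p :=
  hf.smul contDiffAt_const

theorem contDiffAt_formOf (b : Basis ι ℝ E) {F : Type*} [NormedAddCommGroup F] [NormedSpace ℝ F]
    {g : F → Matrix ι ι ℝ} {p : F} (hg : ∀ i j, ContDiffAt ℝ ∞ (fun q => g q i j) p) :
    ContDiffAt ℝ ∞ (fun q => formOf b (g q)) p :=
  ContDiffAt.sum fun i _ => ContDiffAt.sum fun j _ =>  contDiffAt_smul_const (hg i j) _

theorem contDiffAt_connOf (b : Basis ι ℝ E) {F : Type*} [NormedAddCommGroup F] [NormedSpace ℝ F]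
    {γ : F → ι → ι → ι → ℝ} {p : F} (hγ : ∀ c i j, ContDiffAt ℝ ∞ (fun q => γ q c i j) p) :
    ContDiffAt ℝ ∞ (fun q => connOf b (γ q)) p :=
  ContDiffAt.sum fun c _ => ContDiffAt.sum fun i _ => ContDiffAt.sum fun j _ =>
    
    contDiffAt_smul_const (hγ c i j) _

theorem fderiv_clm₂_apply {F G H : Type*} [NormedAddCommGroup F] [NormedSpace ℝ F]
    [NormedAddCommGroup G] [NormedSpace ℝ G] [NormedAddCommGroup H] [NormedSpace ℝ H]
    {B : F → G →L[ℝ] G →L[ℝ] H} {p : F} (hB : DifferentiableAt ℝ B p) (x : F) (u v : G) :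
    fderiv ℝ B p x u v = fderiv ℝ (fun q => B q u v) p x := by
  have hl : HasFDerivAt (fun y => B y u v) _ p :=
    (hB.hasFDerivAt.clm_apply (hasFDerivAt_const u p)).clm_apply (hasFDerivAt_const v p)
  rw [hl.fderiv]
  simp

/-- The connection given by the Christoffel symbols of `g` in the basis `b`. -/
def christoffelConn (b : Basis ι ℝ E) (g : E → Matrix ι ι ℝ) (q : E) : E →L[ℝ] E →L[ℝ] E :=
  connOf b fun c i j => christoffel (dirDeriv b) g c i j q

theorem contDiffAt_christoffelConn (b : Basis ι ℝ E) {g : E → Matrix ι ι ℝ} {p : E}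
    (hg : ∀ i j, ContDiffAt ℝ ∞ (fun q => g q i j) p) (h0 : (g p).det ≠ 0) :
    ContDiffAt ℝ ∞ (christoffelConn b g) p :=
  contDiffAt_connOf b fun c i j => mem_constAlong_empty.1
    (christoffel_mem_constAlong b (fun i j => mem_constAlong_empty.2 (hg i j)) h0 c i j)

/-- The Christoffel symbols represent the Levi-Civita connection. -/
theorem isLeviCivitaAt_christoffelConn (b : Basis ι ℝ E) {g : E → Matrix ι ι ℝ} {q : E}
    (hg : DifferentiableAt ℝ (fun q => formOf b (g q)) q) (h0 : (g q).det ≠ 0)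
    (hs : ∀ i j, g q i j = g q j i) :
    IsLeviCivitaAt (fun q => formOf b (g q)) (christoffelConn b g) q := by
  have key (i j k : ι) : formOf b (g q) (christoffelConn b g q (b i) (b j)) (b k) =
      1 / 2 * (fderiv ℝ (fun q => formOf b (g q)) q (b i) (b j) (b k) +
        fderiv ℝ (fun q => formOf b (g q)) q (b j) (b i) (b k) -
        fderiv ℝ (fun q => formOf b (g q)) q (b k) (b i) (b j)) := by
    simp only [fderiv_clm₂_apply hg, formOf_basis, christoffelConn, connOf_basis, map_sum, map_smul,
      sum_apply, smul_apply, smul_eq_mul]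
    set X : ι → ℝ := fun d => fderiv ℝ (fun q => g q j d) q (b i) +
      fderiv ℝ (fun q => g q i d) q (b j) - fderiv ℝ (fun q => g q i j) q (b d) with hX
    have h1 (c : ι) : christoffel (dirDeriv b) g c i j q = 1 / 2 * ∑ d, (g q)⁻¹ c d * X d := by
      simp [christoffel, dirDeriv, hX]
    have h2 : (g q * (g q)⁻¹).mulVec X = X := by
      rw [Matrix.mul_nonsing_inv _ (isUnit_iff_ne_zero.2 h0), Matrix.one_mulVec]
    have h3 := congrFun h2 k
    rw [← Matrix.mulVec_mulVec] at h3
    change _ = 1 / 2 * X k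
    rw [← h3]
    simp only [Matrix.mulVec, dotProduct, h1, Finset.mul_sum, Finset.sum_mul]
    exact Finset.sum_congr rfl fun c _ => Finset.sum_congr rfl fun d _ => by rw [hs c k]; ring
  intro u v w
  induction u using basis_induction b with
  | h0 => simp
  | hadd u u' h h' => simp only [map_add, add_apply, h, h']; ring
  | hsmul r u h => simp only [map_smul, smul_apply, h, smul_eq_mul]; ring
  | hb i =>
    induction v using basis_induction b with
    | h0 => simp
    | hadd u u' h h' => simp only [map_add, add_apply, h, h']; ring
    | hsmul r u h => simp only [map_smul, smul_apply, h, smul_eq_mul]; ring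
    | hb j =>
      induction w using basis_induction b with
      | h0 => simp
      | hadd u u' h h' => simp only [map_add, add_apply, h, h']; ring
      | hsmul r u h => simp only [map_smul, smul_apply, h, smul_eq_mul]; ring
      | hb k => exact key i j k

/-- The index formula for the Ricci tensor computes the trace of the curvature. -/
theorem ricci_eq_ricciForm (b : Basis ι ℝ E) {g : E → Matrix ι ι ℝ} {p : E}
    (hΓ : DifferentiableAt ℝ (christoffelConn b g) p) (i j : ι) :
    ricci (dirDeriv b) g i j p = ricciForm (christoffelConn b g) p (b i) (b j) := by
  rw [ricciForm_apply, LinearMap.trace_eq_matrix_trace ℝ b, Matrix.trace, ricci]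
  refine Finset.sum_congr rfl fun k _ => ?_
  have hd (x : E) (i j c : ι) : b.repr (fderiv ℝ (christoffelConn b g) p x (b i) (b j)) c =
      fderiv ℝ (christoffel (dirDeriv b) g c i j) p x := by
    have h1 : christoffel (dirDeriv b) g c i j =
        fun q => coordL b c (christoffelConn b g q (b i) (b j)) := by
      ext q
      simp [christoffelConn, repr_connOf_basis]
    have h2 : HasFDerivAt (fun q => coordL b c (christoffelConn b g q (b i) (b j))) _ p :=
      (coordL b c).hasFDerivAt.comp p ((hΓ.hasFDerivAt.clm_apply
        (hasFDerivAt_const (b i) p)).clm_apply (hasFDerivAt_const (b j) p))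
    rw [h1, h2.fderiv]
    simp
  have h2 (i j l : ι) : b.repr (christoffelConn b g p (christoffelConn b g p (b i) (b j)) (b l)) k
      = ∑ f, christoffel (dirDeriv b) g f i j p * christoffel (dirDeriv b) g k f l p := by
    conv_lhs => enter [1, 2, 1, 2]; rw [christoffelConn, connOf_basis]
    simp only [map_sum, map_smul, sum_apply, smul_apply, christoffelConn,
      Finsupp.finsetSum_apply, Finsupp.smul_apply, repr_connOf_basis, smul_eq_mul]
  rw [Matrix.diag_apply, LinearMap.toMatrix_apply, curvature_apply]
  simp only [map_add, map_sub, Finsupp.add_apply, Finsupp.sub_apply, hd, h2, riemann, dirDeriv,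
    Finset.sum_sub_distrib]
  ring

variable {F : Type*} [NormedAddCommGroup F] [NormedSpace ℝ F] [FiniteDimensional ℝ F]
  {κ : Type*} [Fintype κ] [DecidableEq κ]

/-- `g'` is, near `p`, the pullback under the local diffeomorphism `ψ` of the metric with components
`g`, which is smooth, symmetric and non-degenerate near `ψ p`. -/
structure IsPullbackAt (bE : Basis ι ℝ E) (bF : Basis κ ℝ F) (g : E → Matrix ι ι ℝ)
    (g' : F → Matrix κ κ ℝ) (ψ : F → E) (p : F) : Prop where
  contDiffAt_map : ContDiffAt ℝ ∞ ψ p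
  bijective : ∀ᶠ q in 𝓝 p, Function.Bijective (fderiv ℝ ψ q)
  contDiffAt : ∀ i j, ContDiffAt ℝ ∞ (fun q => g q i j) (ψ p)
  symm : ∀ᶠ q in 𝓝 (ψ p), ∀ i j, g q i j = g q j i
  det_ne_zero : (g (ψ p)).det ≠ 0
  eq : ∀ᶠ q in 𝓝 p, ∀ i j,
    g' q i j = formOf bE (g (ψ q)) (fderiv ℝ ψ q (bF i)) (fderiv ℝ ψ q (bF j))

namespace IsPullbackAt

variable {bE : Basis ι ℝ E} {bF : Basis κ ℝ F} {g : E → Matrix ι ι ℝ}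
    {g' : F → Matrix κ κ ℝ} {ψ : F → E} {p : F}

theorem contDiffAt_pullback (h : IsPullbackAt bE bF g g' ψ p) (i j : κ) :
    ContDiffAt ℝ ∞ (fun q => g' q i j) p := by
  refine ContDiffAt.congr_of_eventuallyEq ?_ (h.eq.mono fun q hq => hq i j)
  exact (((contDiffAt_formOf bE h.contDiffAt).comp p h.contDiffAt_map).clm_apply
    ((contDiffAt_fderiv h.contDiffAt_map).clm_apply contDiffAt_const)).clm_apply
    ((contDiffAt_fderiv h.contDiffAt_map).clm_apply contDiffAt_const)

theorem symm_pullback (h : IsPullbackAt bE bF g g' ψ p) :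
    ∀ᶠ q in 𝓝 p, ∀ i j, g' q i j = g' q j i := by
  filter_upwards [h.eq, h.contDiffAt_map.continuousAt.eventually h.symm] with q h1 h2 i j
  rw [h1, h1, formOf_symm _ h2]

theorem formOf_eq {q : F} (h : ∀ i j, g' q i j =
      formOf bE (g (ψ q)) (fderiv ℝ ψ q (bF i)) (fderiv ℝ ψ q (bF j))) (u v : F) :
    formOf bF (g' q) u v = formOf bE (g (ψ q)) (fderiv ℝ ψ q u) (fderiv ℝ ψ q v) := by
  induction u using basis_induction bF with
  | h0 => simp
  | hadd u u' h h' => simp only [map_add, add_apply, h, h']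
  | hsmul r u h => simp only [map_smul, smul_apply, h]
  | hb i =>
    induction v using basis_induction bF with
    | h0 => simp
    | hadd u u' h h' => simp only [map_add, h, h']
    | hsmul r u h => simp only [map_smul, h]
    | hb j => rw [formOf_basis, h]

theorem det_pullback_ne_zero (h : IsPullbackAt bE bF g g' ψ p) : (g' p).det ≠ 0 := by
  have hbij := h.bijective.self_of_nhds
  refine det_ne_zero_of_formOf_nondegenerate bF fun u hu => hbij.1 ?_
  rw [map_zero]
  refine formOf_nondegenerate bE h.det_ne_zero _ fun v => ?_
  obtain ⟨v, rfl⟩ := hbij.2 v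
  rw [← formOf_eq h.eq.self_of_nhds, hu]

/-- Coordinate invariance of the Ricci tensor. -/
theorem ricci_eq (h : IsPullbackAt bE bF g g' ψ p) (i j : κ) :
    ricci (dirDeriv bF) g' i j p =
      Matrix.toBilin bE (Matrix.of fun i j => ricci (dirDeriv bE) g i j (ψ p))
        (fderiv ℝ ψ p (bF i)) (fderiv ℝ ψ p (bF j)) := by
  have hΓ := contDiffAt_christoffelConn bE h.contDiffAt h.det_ne_zero
  have hΓ' := contDiffAt_christoffelConn bF h.contDiffAt_pullback h.det_pullback_ne_zero
  have hB := contDiffAt_formOf bE h.contDiffAt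
  have hB' := contDiffAt_formOf bF h.contDiffAt_pullback
  have hψ := h.contDiffAt_map
  have hdet : ∀ᶠ q in 𝓝 (ψ p), (g q).det ≠ 0 :=
    (mem_constAlong_empty.1 (det_mem_constAlong fun i j =>
      mem_constAlong_empty.2 (h.contDiffAt i j))).continuousAt.eventually_ne h.det_ne_zero
  have hdet' : ∀ᶠ q in 𝓝 p, (g' q).det ≠ 0 :=
    (mem_constAlong_empty.1 (det_mem_constAlong fun i j =>
      mem_constAlong_empty.2 (h.contDiffAt_pullback i j))).continuousAt.eventually_ne
        h.det_pullback_ne_zero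
  have hkey : ∀ᶠ q in 𝓝 p, ∀ u v, fderiv ℝ ψ q (christoffelConn bF g' q u v) =
      fderiv ℝ (fderiv ℝ ψ) q v u +
        christoffelConn bE g (ψ q) (fderiv ℝ ψ q u) (fderiv ℝ ψ q v) := by
    filter_upwards [h.bijective, hψ.continuousAt.eventually h.symm, h.symm_pullback,
      hψ.continuousAt.eventually hdet, hdet', h.eq.eventually_nhds,
      hψ.continuousAt.eventually (eventually_differentiableAt hB), eventually_differentiableAt hB',
      eventually_differentiableAt hψ, eventually_differentiableAt (contDiffAt_fderiv hψ),
      eventually_isSymmSndFDerivAt hψ] with q h1 h2 h3 h4 h5 h6 h7 h8 h9 h10 h11 u v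
    exact (isLeviCivitaAt_christoffelConn bE h7 h4 h2).transform
      (isLeviCivitaAt_christoffelConn bF h8 h5 h3) h7 h8 h9 h10 h11 h1.2
      (formOf_symm bE h2) (formOf_nondegenerate bE h4) (h6.mono fun y hy => formOf_eq hy) u v
  have hform : Matrix.toBilin bE (Matrix.of fun i j => ricci (dirDeriv bE) g i j (ψ p)) =
      ricciForm (christoffelConn bE g) (ψ p) := by
    refine LinearMap.BilinForm.ext_basis bE fun i j => ?_
    rw [← ricci_eq_ricciForm bE (hΓ.differentiableAt (by simp))]
    simp [Matrix.toBilin_apply, Finsupp.single_apply]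
  rw [hform, ricci_eq_ricciForm bF (hΓ'.differentiableAt (by simp))]
  exact ricciForm_transform hψ h.bijective.self_of_nhds (hΓ.differentiableAt (by simp))
    (hΓ'.differentiableAt (by simp)) hkey _ _

end IsPullbackAt

end Bridge

/-! ### Ricci tensor of a product metric -/

section Product

variable {E : Type*} [NormedAddCommGroup E] [NormedSpace ℝ E]
  {ι κ : Type*} [Fintype ι] [DecidableEq ι] [Fintype κ] [DecidableEq κ]

theorem dirDeriv_zero (w : ι → E) (i : ι) (p : E) : dirDeriv w i (fun _ => 0) p = 0 := by
  simp [dirDeriv]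

theorem fromBlocks_diagonal_inv {A : Matrix ι ι ℝ} {B : Matrix κ κ ℝ} (hA : A.det ≠ 0)
    (hB : B.det ≠ 0) :
    (Matrix.fromBlocks A 0 0 B)⁻¹ = Matrix.fromBlocks A⁻¹ 0 0 B⁻¹ := by
  refine Matrix.inv_eq_right_inv ?_
  rw [Matrix.fromBlocks_multiply, Matrix.mul_nonsing_inv _ (isUnit_iff_ne_zero.2 hA),
    Matrix.mul_nonsing_inv _ (isUnit_iff_ne_zero.2 hB)]
  simp

/-- The Christoffel symbols of a product metric: those of the factors, and zero for mixed
indices. -/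
def blockChristoffel (w : ι ⊕ κ → E) (g₁ : E → Matrix ι ι ℝ) (g₂ : E → Matrix κ κ ℝ) :
    ι ⊕ κ → ι ⊕ κ → ι ⊕ κ → E → ℝ
  | .inl c, .inl a, .inl b => christoffel (dirDeriv (w ∘ Sum.inl)) g₁ c a b
  | .inr c, .inr a, .inr b => christoffel (dirDeriv (w ∘ Sum.inr)) g₂ c a b
  | _, _, _ => fun _ => 0

theorem christoffel_fromBlocks {w : ι ⊕ κ → E} {g₁ : E → Matrix ι ι ℝ} {g₂ : E → Matrix κ κ ℝ}
    {q : E} (h1 : ∀ i j k, fderiv ℝ (fun q => g₁ q i j) q (w (.inr k)) = 0)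
    (h2 : ∀ i j k, fderiv ℝ (fun q => g₂ q i j) q (w (.inl k)) = 0)
    (hd1 : (g₁ q).det ≠ 0) (hd2 : (g₂ q).det ≠ 0) (c a b : ι ⊕ κ) :
    christoffel (dirDeriv w) (fun q => Matrix.fromBlocks (g₁ q) 0 0 (g₂ q)) c a b q =
      blockChristoffel w g₁ g₂ c a b q := by
  rcases c with c | c <;> rcases a with a | a <;> rcases b with b | b <;>
  simp [christoffel, blockChristoffel, fromBlocks_diagonal_inv hd1 hd2, dirDeriv, h1, h2]

theorem ricci_fromBlocks {w : ι ⊕ κ → E} {g₁ : E → Matrix ι ι ℝ} {g₂ : E → Matrix κ κ ℝ}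
    {p : E} (h1 : ∀ i j, (fun q => g₁ q i j) ∈ constAlong (Set.range (w ∘ Sum.inr)) p)
    (h2 : ∀ i j, (fun q => g₂ q i j) ∈ constAlong (Set.range (w ∘ Sum.inl)) p)
    (hd1 : (g₁ p).det ≠ 0) (hd2 : (g₂ p).det ≠ 0) (i j : ι ⊕ κ) :
    ricci (dirDeriv w) (fun q => Matrix.fromBlocks (g₁ q) 0 0 (g₂ q)) i j p =
      Matrix.fromBlocks (Matrix.of fun i j => ricci (dirDeriv (w ∘ Sum.inl)) g₁ i j p) 0 0
        (Matrix.of fun i j => ricci (dirDeriv (w ∘ Sum.inr)) g₂ i j p) i j := by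
  have he (c a b : ι ⊕ κ) :
      christoffel (dirDeriv w) (fun q => Matrix.fromBlocks (g₁ q) 0 0 (g₂ q)) c a b =ᶠ[𝓝 p]
        blockChristoffel w g₁ g₂ c a b := by
    have e1 := eventually_all.2 fun i => eventually_all.2 fun j => (h1 i j).2
    have e2 := eventually_all.2 fun i => eventually_all.2 fun j => (h2 i j).2
    filter_upwards [e1, e2, (det_mem_constAlong h1).1.continuousAt.eventually_ne hd1,
      (det_mem_constAlong h2).1.continuousAt.eventually_ne hd2] with q k1 k2 k3 k4
    exact christoffel_fromBlocks (fun i j k => k1 i j _ ⟨k, rfl⟩) (fun i j k => k2 i j _ ⟨k, rfl⟩)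
      k3 k4 c a b
  have hD (k c a b : ι ⊕ κ) : dirDeriv w k
      (christoffel (dirDeriv w) (fun q => Matrix.fromBlocks (g₁ q) 0 0 (g₂ q)) c a b) p =
        dirDeriv w k (blockChristoffel w g₁ g₂ c a b) p := by
    rw [dirDeriv, (he c a b).fderiv_eq, dirDeriv]
  have hv (c a b : ι ⊕ κ) := (he c a b).self_of_nhds
  -- The Christoffel symbols of each factor are constant along the other factor; this makes the
  -- mixed components vanish.
  have z1 (k : κ) (c a b : ι) : dirDeriv w (.inr k)
      (christoffel (dirDeriv (w ∘ Sum.inl)) g₁ c a b) p = 0 :=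
    (christoffel_mem_constAlong _ h1 hd1 c a b).2.self_of_nhds _ ⟨k, rfl⟩
  have z2 (k : ι) (c a b : κ) : dirDeriv w (.inl k)
      (christoffel (dirDeriv (w ∘ Sum.inr)) g₂ c a b) p = 0 :=
    (christoffel_mem_constAlong _ h2 hd2 c a b).2.self_of_nhds _ ⟨k, rfl⟩
  have l1 (k : ι) (f : E → ℝ) : dirDeriv w (.inl k) f p = dirDeriv (w ∘ Sum.inl) k f p := rfl
  have l2 (k : κ) (f : E → ℝ) : dirDeriv w (.inr k) f p = dirDeriv (w ∘ Sum.inr) k f p := rfl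
  simp only [ricci, riemann, hD, hv]
  rcases i with i | i <;> rcases j with j | j
  · simp [blockChristoffel, dirDeriv_zero, l1]
  · simp [blockChristoffel, z2, dirDeriv_zero]
  · simp [blockChristoffel, z1, dirDeriv_zero]
  · simp [blockChristoffel, dirDeriv_zero, l2]

end Product

/-! ### The two real projections of the para-complex numbers -/

section Projection

/-- The ring homomorphism `x + ey ↦ x + sy`, for `s = ±1`. -/
def proj (s : ℝ) (hs : s * s = 1) : ParaComplex →+* ℝ where
  toFun z := z.re + s * z.im
  map_one' := by
    change (1 : ParaComplex).re + s * (1 : ParaComplex).im = 1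
    simp [QuadraticAlgebra.re_one, QuadraticAlgebra.im_one]
  map_mul' z w := by
    simp only [QuadraticAlgebra.re_mul, QuadraticAlgebra.im_mul]
    linear_combination (- z.im * w.im) * hs
  map_zero' := by simp
  map_add' z w := by simp; ring

variable {s : ℝ} (hs : s * s = 1)

theorem proj_apply (z : ParaComplex) : proj s hs z = z.re + s * z.im := rfl

theorem proj_smul (r : ℝ) (z : ParaComplex) : proj s hs (r • z) = r * proj s hs z := by
  simp [proj_apply]; ring

theorem proj_e_mul (z : ParaComplex) : proj s hs (e * z) = s * proj s hs z := by
  rw [map_mul]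
  simp [proj_apply, e]

/-- The idempotents `(1 ± e)/2` split `C` as `ℝ × ℝ`. -/
theorem paraComplex_ext_proj {z w : ParaComplex}
    (h : ∀ s (hs : s * s = 1), proj s hs z = proj s hs w) : z = w := by
  have h1 := h 1 (by norm_num)
  have h2 := h (-1) (by norm_num)
  simp only [proj_apply] at h1 h2
  ext <;> linarith

theorem isUnit_of_proj_ne_zero {z : ParaComplex}
    (h : ∀ s (hs : s * s = 1), proj s hs z ≠ 0) : IsUnit z := by
  have h1 := h 1 (by norm_num)
  have h2 := h (-1) (by norm_num)
  simp only [proj_apply] at h1 h2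
  rw [QuadraticAlgebra.isUnit_iff_norm_isUnit, isUnit_iff_ne_zero, QuadraticAlgebra.norm_def]
  have := mul_ne_zero h1 h2
  contrapose! this
  linear_combination this

variable {n : ℕ}

/-- The null direction `½ (∂/∂x^a + s ∂/∂y^a)`. -/
def nullVec (n : ℕ) (s : ℝ) (a : Fin n) : CModel n := (1 / 2 : ℝ) • (dirX a + s • dirY a)

theorem fderiv_proj {f : CModel n → ParaComplex} {p : CModel n}
    (h1 : DifferentiableAt ℝ (fun q => (f q).re) p) (h2 : DifferentiableAt ℝ (fun q => (f q).im) p)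
    (v : CModel n) : fderiv ℝ (fun q => proj s hs (f q)) p v = proj s hs (derivC f p v) := by
  have : HasFDerivAt (fun q => proj s hs (f q)) _ p :=
    h1.hasFDerivAt.add (h2.hasFDerivAt.const_mul s)
  rw [this.fderiv]
  simp [proj_apply, derivC]

/-- `∂/∂z^a` projects to the derivative along the null direction of sign `s`. -/
theorem proj_dz {f : CModel n → ParaComplex} {p : CModel n}
    (h1 : DifferentiableAt ℝ (fun q => (f q).re) p) (h2 : DifferentiableAt ℝ (fun q => (f q).im) p)
    (a : Fin n) :
    proj s hs (dz a f p) = dirDeriv (nullVec n s) a (fun q => proj s hs (f q)) p := by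
  rw [dirDeriv, nullVec, map_smul, map_add, map_smul, fderiv_proj hs h1 h2, fderiv_proj hs h1 h2,
    dz, proj_smul, map_add, proj_e_mul, smul_eq_mul, smul_eq_mul]

/-- `∂/∂z̄^a` projects to the derivative along the null direction of sign `-s`. -/
theorem proj_dzbar {f : CModel n → ParaComplex} {p : CModel n}
    (h1 : DifferentiableAt ℝ (fun q => (f q).re) p) (h2 : DifferentiableAt ℝ (fun q => (f q).im) p)
    (a : Fin n) :
    proj s hs (dzbar a f p) = dirDeriv (nullVec n (-s)) a (fun q => proj s hs (f q)) p := by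
  rw [dirDeriv, nullVec, map_smul, map_add, map_smul, fderiv_proj hs h1 h2, fderiv_proj hs h1 h2,
    dzbar, proj_smul, map_sub, proj_e_mul, smul_eq_mul, smul_eq_mul]
  ring

theorem proj_christoffel {g : CModel n → Matrix (Fin n) (Fin n) ParaComplex} {q : CModel n}
    (h1 : ∀ i j, DifferentiableAt ℝ (fun q => (g q i j).re) q)
    (h2 : ∀ i j, DifferentiableAt ℝ (fun q => (g q i j).im) q)
    (hu : IsUnit (g q).det) (c a b : Fin n) :
    proj s hs (christoffel dz g c a b q) =
      christoffel (dirDeriv (nullVec n s)) (fun q => (g q).map (proj s hs)) c a b q := by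
  have hinv : ((g q).map (proj s hs))⁻¹ = ((g q)⁻¹).map (proj s hs) := by
    refine Matrix.inv_eq_right_inv ?_
    rw [← Matrix.map_mul, Matrix.mul_nonsing_inv _ hu]
    simp
  simp only [christoffel, proj_smul, map_sum, map_mul, map_add, map_sub,
    proj_dz hs (h1 _ _) (h2 _ _), hinv, Matrix.map_apply, smul_eq_mul]

/-- The Ricci tensor of a para-complex metric projects to the Ricci tensors of its two real
projections. -/
theorem proj_ricci {g : CModel n → Matrix (Fin n) (Fin n) ParaComplex} {p : CModel n}
    (h1 : ∀ i j, ContDiffAt ℝ ∞ (fun q => (g q i j).re) p)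
    (h2 : ∀ i j, ContDiffAt ℝ ∞ (fun q => (g q i j).im) p)
    (hu : ∀ s (hs : s * s = 1), ((g p).map (proj s hs)).det ≠ 0) (a b : Fin n) :
    proj s hs (ricci dz g a b p) =
      ricci (dirDeriv (nullVec n s)) (fun q => (g q).map (proj s hs)) a b p := by
  have hmem (s : ℝ) (hs : s * s = 1) (i j : Fin n) :
      (fun q => (g q).map (proj s hs) i j) ∈ constAlong ∅ p :=
    mem_constAlong_empty.2 ((h1 i j).add (contDiffAt_const.mul (h2 i j)))
  have hdet (s : ℝ) (hs : s * s = 1) : ∀ᶠ q in 𝓝 p, ((g q).map (proj s hs)).det ≠ 0 :=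
    (det_mem_constAlong (hmem s hs)).1.continuousAt.eventually_ne (hu s hs)
  have hone : (1 : ℝ) * 1 = 1 := by norm_num
  have hneg : (-1 : ℝ) * -1 = 1 := by norm_num
  have hunit : ∀ᶠ q in 𝓝 p, IsUnit (g q).det := by
    filter_upwards [hdet 1 hone, hdet (-1) hneg] with q k1 k2
    refine isUnit_of_proj_ne_zero fun s hs => ?_
    rw [RingHom.map_det]
    rcases mul_self_eq_one_iff.1 hs with rfl | rfl
    exacts [k1, k2]
  have hC (s : ℝ) (hs : s * s = 1) (c a b : Fin n) :
      (fun q => proj s hs (christoffel dz g c a b q)) =ᶠ[𝓝 p]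
        christoffel (dirDeriv (nullVec n s)) (fun q => (g q).map (proj s hs)) c a b := by
    filter_upwards [eventually_all.2 fun i => eventually_all.2 fun j =>
      eventually_differentiableAt (h1 i j), eventually_all.2 fun i => eventually_all.2 fun j =>
      eventually_differentiableAt (h2 i j), hunit] with q k1 k2 k3
    exact proj_christoffel hs k1 k2 k3 c a b
  have hCs (s : ℝ) (hs : s * s = 1) (c a b : Fin n) :
      DifferentiableAt ℝ (fun q => proj s hs (christoffel dz g c a b q)) p :=
    (((christoffel_mem_constAlong _ (hmem s hs) (hu s hs) c a b).1.congr_of_eventuallyEq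
      (hC s hs c a b))).differentiableAt (by simp)
  have hre (c a b : Fin n) : DifferentiableAt ℝ (fun q => (christoffel dz g c a b q).re) p := by
    have h : (fun q => (christoffel dz g c a b q).re) = fun q => 1 / 2 *
        (proj 1 hone (christoffel dz g c a b q) + proj (-1) hneg (christoffel dz g c a b q)) := by
      ext q
      simp only [proj_apply]
      ring
    rw [h]
    exact ((hCs 1 hone c a b).add (hCs (-1) hneg c a b)).const_mul (1 / 2)
  have him (c a b : Fin n) : DifferentiableAt ℝ (fun q => (christoffel dz g c a b q).im) p := by
    have h : (fun q => (christoffel dz g c a b q).im) = fun q => 1 / 2 *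
        (proj 1 hone (christoffel dz g c a b q) - proj (-1) hneg (christoffel dz g c a b q)) := by
      ext q
      simp only [proj_apply]
      ring
    rw [h]
    exact ((hCs 1 hone c a b).sub (hCs (-1) hneg c a b)).const_mul (1 / 2)
  have hD (k c a b : Fin n) : proj s hs (dz k (christoffel dz g c a b) p) =
      dirDeriv (nullVec n s) k
        (christoffel (dirDeriv (nullVec n s)) (fun q => (g q).map (proj s hs)) c a b) p := by
    rw [proj_dz hs (hre _ _ _) (him _ _ _), dirDeriv, (hC s hs c a b).fderiv_eq, dirDeriv]
  simp only [ricci, riemann, map_sum, map_add, map_sub, map_mul, hD, (hC s hs _ _ _).self_of_nhds]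

/-- The linear change of coordinates `(u, v) ↦ (½ (u + v), ½ (u - v))` of `ℝⁿ × ℝⁿ`. -/
def nullEquiv (n : ℕ) : ((Fin n → ℝ) × (Fin n → ℝ)) ≃ₗ[ℝ] CModel n where
  toFun z := ((1 / 2 : ℝ) • (z.1 + z.2), (1 / 2 : ℝ) • (z.1 - z.2))
  invFun z := (z.1 + z.2, z.1 - z.2)
  map_add' z w := by ext <;> simp <;> ring
  map_smul' r z := by ext <;> simp <;> ring
  left_inv z := by ext <;> simp <;> ring
  right_inv z := by ext <;> simp <;> ring

/-- The basis of `Cⁿ` formed by the null directions `½ (∂/∂x^a ± ∂/∂y^a)`. -/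
def nullBasis (n : ℕ) : Basis (Fin n ⊕ Fin n) ℝ (CModel n) :=
  ((Pi.basisFun ℝ (Fin n)).prod (Pi.basisFun ℝ (Fin n))).map (nullEquiv n)

theorem nullBasis_inl (a : Fin n) : nullBasis n (Sum.inl a) = nullVec n 1 a := by
  ext <;> simp [nullBasis, nullEquiv, nullVec, dirX, dirY]

theorem nullBasis_inr (a : Fin n) : nullBasis n (Sum.inr a) = nullVec n (-1) a := by
  ext <;> simp [nullBasis, nullEquiv, nullVec, dirX, dirY]

end Projection

section

variable {n : ℕ} {M : Type*} [TopologicalSpace M] [ChartedSpace (RModel n) M]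

/-! ### Real tangent vectors and type `(1,0)` vectors -/

section Hat

variable [IsManifold (𝓡 (2 * n)) ∞ M] (J : ParaComplexStructure n M)

theorem e_mul_e : e * e = 1 := by
  ext
  · simp [e]; rfl
  · simp [e]; rfl

theorem e_smul_one_tmul {x : M} (v : T n x) : e • ((1 : ParaComplex) ⊗ₜ[ℝ] v) = e ⊗ₜ[ℝ] v := by
  rw [TensorProduct.smul_tmul', smul_eq_mul, mul_one]

theorem e_smul_e_tmul {x : M} (v : T n x) : e • (e ⊗ₜ[ℝ] v) = (1 : ParaComplex) ⊗ₜ[ℝ] v := by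
  rw [TensorProduct.smul_tmul', smul_eq_mul, e_mul_e]

theorem hat_apply (x : M) (X : T n x) : hat J x X =
    (1 / 2 : ℝ) • ((1 : ParaComplex) ⊗ₜ[ℝ] X + e ⊗ₜ[ℝ] J.I x X) := rfl

theorem hat_I (x : M) (X : T n x) : hat J x (J.I x X) = e • hat J x X := by
  rw [hat_apply, hat_apply, J.sq, smul_comm e, smul_add e, e_smul_one_tmul, e_smul_e_tmul, add_comm]

theorem conjT_hat (x : M) (X : T n x) : conjT x (hat J x X) =
    (1 / 2 : ℝ) • ((1 : ParaComplex) ⊗ₜ[ℝ] X - e ⊗ₜ[ℝ] J.I x X) := by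
  have h1 : conjC 1 = 1 := by
    ext
    · rfl
    · exact neg_zero
  have h2 : conjC e = -e := by ext <;> simp [conjC, e]
  rw [hat_apply, map_smul, map_add, conjT, LinearMap.rTensor_tmul, LinearMap.rTensor_tmul, h1, h2,
    TensorProduct.neg_tmul, sub_eq_add_neg]

theorem hat_mem_T10 (x : M) (X : T n x) : hat J x X ∈ T10 J x := by
  rw [T10, Module.End.mem_eigenspace_iff, hat_apply]
  simp only [IC, LinearMap.map_smul_of_tower, map_add, LinearMap.baseChange_tmul,
    ContinuousLinearMap.coe_coe, J.sq]
  rw [smul_comm e, smul_add e, e_smul_one_tmul, e_smul_e_tmul, add_comm]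

theorem conjT_hat_mem_T01 (x : M) (X : T n x) : conjT x (hat J x X) ∈ T01 J x := by
  rw [T01, Module.End.mem_eigenspace_iff, conjT_hat]
  simp only [IC, LinearMap.map_smul_of_tower, map_sub, LinearMap.baseChange_tmul,
    ContinuousLinearMap.coe_coe, J.sq]
  rw [smul_comm (-e), neg_smul, smul_sub e, e_smul_one_tmul, e_smul_e_tmul, neg_sub]

variable {J} (G : ParaComplexMetric J)

/-- The real metric is the restriction of `Re G` to real tangent vectors; this gives its smoothness
without reference to that of `I`. -/
theorem real_eq_re_form (x : M) (X Y : T n x) : G.real x X Y =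
    (G.form x ((1 : ParaComplex) ⊗ₜ[ℝ] X) ((1 : ParaComplex) ⊗ₜ[ℝ] Y)).re := by
  have hs (X : T n x) : (1 : ParaComplex) ⊗ₜ[ℝ] X = hat J x X + conjT x (hat J x X) := by
    rw [conjT_hat, hat_apply]
    module
  have h1 := G.orthogonal x _ (hat_mem_T10 J x X) _ (conjT_hat_mem_T01 J x Y)
  have h2 := G.orthogonal x _ (hat_mem_T10 J x Y) _ (conjT_hat_mem_T01 J x X)
  rw [G.symm] at h2
  rw [hs X, hs Y, ParaComplexMetric.real_apply]
  simp only [map_add, LinearMap.add_apply, h1, h2, G.conj]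
  simp [conjC]
  ring

/-- Transport of the real metric along an equality of points, all tangent spaces being copies of the
model space. -/
theorem real_congr {x y : M} (h : x = y) (X Y : RModel n) :
    G.real x (X : T n x) (Y : T n x) = G.real y (X : T n y) (Y : T n y) := by
  subst h
  rfl

end Hat

/-! ### Smooth coordinate systems -/

section Charts

variable {F : Type*} [NormedAddCommGroup F] [NormedSpace ℝ F]
  {F' : Type*} [NormedAddCommGroup F'] [NormedSpace ℝ F']

variable (n) in
/-- Coordinate systems of `M` with values in a normed space, smooth together with their inverse. -/
structure IsSmoothChart (φ : OpenPartialHomeomorph M F) : Prop where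
  smooth : ContMDiffOn (𝓡 (2 * n)) 𝓘(ℝ, F) ∞ φ φ.source
  smooth_symm : ContMDiffOn 𝓘(ℝ, F) (𝓡 (2 * n)) ∞ φ.symm φ.target

theorem IsParaHolChart.isSmoothChart [IsManifold (𝓡 (2 * n)) ∞ M] {J : ParaComplexStructure n M}
    {φ : OpenPartialHomeomorph M (CModel n)} (h : IsParaHolChart J φ) : IsSmoothChart n φ :=
  ⟨h.smooth, h.smooth_symm⟩

theorem isSmoothChart_of_mem_maximalAtlas {φ : OpenPartialHomeomorph M (RModel n)}
    (h : φ ∈ IsManifold.maximalAtlas (𝓡 (2 * n)) ∞ M) : IsSmoothChart n φ :=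
  ⟨contMDiffOn_of_mem_maximalAtlas h, contMDiffOn_symm_of_mem_maximalAtlas h⟩

namespace IsSmoothChart

variable {φ : OpenPartialHomeomorph M F} {φ' : OpenPartialHomeomorph M F'}

theorem mdifferentiable (h : IsSmoothChart n φ) : φ.MDifferentiable (𝓡 (2 * n)) 𝓘(ℝ, F) :=
  ⟨h.smooth.mdifferentiableOn (by simp), h.smooth_symm.mdifferentiableOn (by simp)⟩

variable [IsManifold (𝓡 (2 * n)) ∞ M]

theorem mfderiv_coordVec (h : IsSmoothChart n φ) {q : F} (hq : q ∈ φ.target) (v : F) :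
    (mfderiv (𝓡 (2 * n)) 𝓘(ℝ, F) φ (φ.symm q) (coordVec φ q v) : F) = v :=
  congrArg (fun L => L v) (h.mdifferentiable.comp_symm_deriv hq)

theorem coordVec_mfderiv (h : IsSmoothChart n φ) {x : M} (hx : x ∈ φ.source) (X : T n x) :
    (coordVec φ (φ x) (mfderiv (𝓡 (2 * n)) 𝓘(ℝ, F) φ x X : F) : RModel n) = (X : RModel n) :=
  congrArg (fun L => L X) (h.mdifferentiable.symm_comp_deriv hx)

theorem bijective_mfderiv (h : IsSmoothChart n φ) {x : M} (hx : x ∈ φ.source) :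
    Function.Bijective (mfderiv (𝓡 (2 * n)) 𝓘(ℝ, F) φ x) :=
  h.mdifferentiable.mfderiv_bijective hx

theorem coordVec_surjective (h : IsSmoothChart n φ) {q : F} (hq : q ∈ φ.target)
    (X : T n (φ.symm q)) : ∃ v, coordVec φ q v = X := by
  refine ⟨(mfderiv (𝓡 (2 * n)) 𝓘(ℝ, F) φ (φ.symm q) X : F), ?_⟩
  exact (h.bijective_mfderiv (φ.map_target hq)).1 (h.mfderiv_coordVec hq _)

theorem coordVec_injective (h : IsSmoothChart n φ) {q : F} (hq : q ∈ φ.target) :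
    Function.Injective (coordVec (n := n) φ q) := by
  intro u v huv
  rw [← h.mfderiv_coordVec hq u, huv, h.mfderiv_coordVec hq v]

theorem coordVec_bijective (h : IsSmoothChart n φ) {q : F} (hq : q ∈ φ.target) :
    Function.Bijective (coordVec (n := n) φ q) :=
  ⟨h.coordVec_injective hq, h.coordVec_surjective hq⟩

theorem contDiffAt_transition (h : IsSmoothChart n φ) (h' : IsSmoothChart n φ') {q : F}
    (hq : q ∈ φ.target) (hq' : φ.symm q ∈ φ'.source) : ContDiffAt ℝ ∞ (φ' ∘ φ.symm) q := by
  rw [← contMDiffAt_iff_contDiffAt]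
  exact (h'.smooth.contMDiffAt (φ'.open_source.mem_nhds hq')).comp q
    (h.smooth_symm.contMDiffAt (φ.open_target.mem_nhds hq))

theorem fderiv_transition (h : IsSmoothChart n φ) (h' : IsSmoothChart n φ') {q : F}
    (hq : q ∈ φ.target) (hq' : φ.symm q ∈ φ'.source) (v : F) : fderiv ℝ (φ' ∘ φ.symm) q v =
      (mfderiv (𝓡 (2 * n)) 𝓘(ℝ, F') φ' (φ.symm q) (coordVec φ q v) : F') := by
  rw [← mfderiv_eq_fderiv, mfderiv_comp q (h'.mdifferentiable.mdifferentiableAt hq')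
    (h.mdifferentiable.mdifferentiableAt_symm hq)]
  rfl

theorem bijective_fderiv_transition (h : IsSmoothChart n φ) (h' : IsSmoothChart n φ') {q : F}
    (hq : q ∈ φ.target) (hq' : φ.symm q ∈ φ'.source) :
    Function.Bijective (fderiv ℝ (φ' ∘ φ.symm) q) := by
  have : ⇑(fderiv ℝ (φ' ∘ φ.symm) q) =
      (mfderiv (𝓡 (2 * n)) 𝓘(ℝ, F') φ' (φ.symm q)) ∘ coordVec φ q :=
    funext fun v => h.fderiv_transition h' hq hq' v
  rw [this]
  exact (h'.bijective_mfderiv hq').comp (h.coordVec_bijective hq)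

end IsSmoothChart

end Charts

end

section

variable {n : ℕ} {M : Type*} [TopologicalSpace M] [ChartedSpace (RModel n) M]
  [IsManifold (𝓡 (2 * n)) ∞ M] {J : ParaComplexStructure n M} (G : ParaComplexMetric J)

/-! ### The real metric in coordinates -/

section Components

variable {F : Type*} [NormedAddCommGroup F] [NormedSpace ℝ F]
  {F' : Type*} [NormedAddCommGroup F'] [NormedSpace ℝ F']
  {φ : OpenPartialHomeomorph M F} {φ' : OpenPartialHomeomorph M F'}
  {ι : Type*} [Fintype ι] [DecidableEq ι]

theorem coordVec_add (q u v : F) :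
    (coordVec φ q (u + v) : T n (φ.symm q)) = coordVec φ q u + coordVec φ q v :=
  map_add (mfderiv 𝓘(ℝ, F) (𝓡 (2 * n)) φ.symm q) u v

theorem coordVec_smul (q : F) (r : ℝ) (u : F) :
    (coordVec φ q (r • u) : T n (φ.symm q)) = r • coordVec φ q u :=
  map_smul (mfderiv 𝓘(ℝ, F) (𝓡 (2 * n)) φ.symm q) r u

theorem coordVec_zero (q : F) : (coordVec φ q 0 : T n (φ.symm q)) = 0 :=
  map_zero (mfderiv 𝓘(ℝ, F) (𝓡 (2 * n)) φ.symm q)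

/-- Two bilinear forms agree if they agree on the coordinate vectors of a basis. -/
theorem bilin_ext_coordVec [FiniteDimensional ℝ F] (b : Basis ι ℝ F) {q : F}
    {B B' : LinearMap.BilinForm ℝ (T n (φ.symm q))}
    (h : ∀ i j, B (coordVec φ q (b i)) (coordVec φ q (b j)) =
      B' (coordVec φ q (b i)) (coordVec φ q (b j))) (u v : F) :
    B (coordVec φ q u) (coordVec φ q v) = B' (coordVec φ q u) (coordVec φ q v) := by
  induction u using basis_induction b with
  | h0 => simp only [coordVec_zero, map_zero, LinearMap.zero_apply]
  | hadd u u' h h' => simp only [coordVec_add, map_add, LinearMap.add_apply, h, h']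
  | hsmul r u h => simp only [coordVec_smul, map_smul, LinearMap.smul_apply, h]
  | hb i =>
    induction v using basis_induction b with
    | h0 => simp only [coordVec_zero, map_zero]
    | hadd u u' h h' => simp only [coordVec_add, map_add, h, h']
    | hsmul r u h => simp only [coordVec_smul, map_smul, h]
    | hb j => exact h i j

/-- The components of the real metric in the coordinate system `φ`, with respect to a basis of the
model space. -/
def metricComponents (φ : OpenPartialHomeomorph M F) (b : Basis ι ℝ F) (q : F) : Matrix ι ι ℝ :=
  Matrix.of fun i j => G.real (φ.symm q) (coordVec φ q (b i)) (coordVec φ q (b j))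

theorem formOf_metricComponents [FiniteDimensional ℝ F] (b : Basis ι ℝ F) (q u v : F) :
    formOf b (metricComponents G φ b q) u v =
      G.real (φ.symm q) (coordVec φ q u) (coordVec φ q v) := by
  induction u using basis_induction b with
  | h0 => simp only [coordVec_zero, map_zero, LinearMap.zero_apply, zero_apply]
  | hadd u u' h h' => simp only [coordVec_add, map_add, LinearMap.add_apply, add_apply, h, h']
  | hsmul r u h => simp only [coordVec_smul, map_smul, LinearMap.smul_apply, smul_apply, h]
  | hb i =>
    induction v using basis_induction b with
    | h0 => simp only [coordVec_zero, map_zero]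
    | hadd u u' h h' => simp only [coordVec_add, map_add, h, h']
    | hsmul r u h => simp only [coordVec_smul, map_smul, h]
    | hb j => rw [formOf_basis]; rfl

theorem det_metricComponents_ne_zero [FiniteDimensional ℝ F] (hφ : IsSmoothChart n φ)
    (b : Basis ι ℝ F) {q : F} (hq : q ∈ φ.target) : (metricComponents G φ b q).det ≠ 0 := by
  refine det_ne_zero_of_formOf_nondegenerate b fun u hu => hφ.coordVec_injective hq ?_
  rw [coordVec_zero]
  refine (G.real_nondegenerate (φ.symm q)).1 _ fun Y => ?_
  obtain ⟨v, rfl⟩ := hφ.coordVec_surjective hq Y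
  rw [← formOf_metricComponents G b, hu]

theorem metricComponents_symm (b : Basis ι ℝ F) (q : F) (i j : ι) :
    metricComponents G φ b q i j = metricComponents G φ b q j i :=
  G.real_symm _ _ _

/-- The real metric, evaluated on coordinate vectors, transforms by the derivative of the coordinate
change. -/
theorem real_transition (hφ : IsSmoothChart n φ) (hφ' : IsSmoothChart n φ') {q : F}
    (hq : q ∈ φ.target) (hq' : φ.symm q ∈ φ'.source) (u v : F) :
    G.real (φ'.symm ((φ' ∘ φ.symm) q))
      (coordVec φ' ((φ' ∘ φ.symm) q) (fderiv ℝ (φ' ∘ φ.symm) q u))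
      (coordVec φ' ((φ' ∘ φ.symm) q) (fderiv ℝ (φ' ∘ φ.symm) q v)) =
    G.real (φ.symm q) (coordVec φ q u) (coordVec φ q v) := by
  have h (u : F) : (coordVec φ' ((φ' ∘ φ.symm) q) (fderiv ℝ (φ' ∘ φ.symm) q u) : RModel n) =
      (coordVec φ q u : RModel n) := by
    rw [hφ.fderiv_transition hφ' hq hq']
    exact hφ'.coordVec_mfderiv hq' _
  refine Eq.trans ?_ (real_congr G (φ'.left_inv hq') (coordVec φ q u) (coordVec φ q v))
  exact congrArg₂ (fun X Y : RModel n => G.real (φ'.symm ((φ' ∘ φ.symm) q)) X Y) (h u) (h v)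

end Components

/-- The standard basis of the model space. -/
abbrev stdBasis (n : ℕ) : Basis (Fin (2 * n)) ℝ (RModel n) :=
  (EuclideanSpace.basisFun (Fin (2 * n)) ℝ).toBasis

theorem realComponents_eq (φ : OpenPartialHomeomorph M (RModel n)) :
    G.realComponents φ = metricComponents G φ (stdBasis n) := by
  ext q i j
  simp [ParaComplexMetric.realComponents, metricComponents]

theorem partialR_eq :
    (ParaComplexMetric.partialR : Fin (2 * n) → (RModel n → ℝ) → RModel n → ℝ) =
      dirDeriv (stdBasis n) := by
  ext i f p
  simp [ParaComplexMetric.partialR, dirDeriv]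

theorem contDiffAt_realComponents {φ : OpenPartialHomeomorph M (RModel n)}
    (hφ : φ ∈ IsManifold.maximalAtlas (𝓡 (2 * n)) ∞ M) {q : RModel n} (hq : q ∈ φ.target)
    (i j : Fin (2 * n)) : ContDiffAt ℝ ∞ (fun q => metricComponents G φ (stdBasis n) q i j) q := by
  have h := (G.smooth_re φ hφ (stdBasis n i) (stdBasis n j)).contDiffAt
    (φ.open_target.mem_nhds hq)
  refine h.congr_of_eventuallyEq (Eventually.of_forall fun q => ?_)
  exact real_eq_re_form G _ _ _

/-- The right-hand side `l₁ g(X, Y) + l₂ g(X, I Y)` as a bilinear form. -/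
def einsteinForm (l₁ l₂ : ℝ) (x : M) : LinearMap.BilinForm ℝ (T n x) :=
  l₁ • G.real x + l₂ • (G.real x).compRight (J.I x).toLinearMap

theorem einsteinForm_apply (l₁ l₂ : ℝ) (x : M) (X Y : T n x) :
    einsteinForm G l₁ l₂ x X Y = l₁ * G.real x X Y + l₂ * G.real x X (J.I x Y) := rfl

/-! ### The metric in para-holomorphic coordinates -/

section ParaHolCoordinates

variable {φ : OpenPartialHomeomorph M (CModel n)} (hφ : IsParaHolChart J φ)
include hφ

/-- In para-holomorphic coordinates, `I` is the exchange `(x, y) ↦ (y, x)`. -/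
theorem I_coordVec {q : CModel n} (hq : q ∈ φ.target) (v : CModel n) :
    J.I (φ.symm q) (coordVec φ q v) = coordVec φ q v.swap := by
  apply (hφ.isSmoothChart.bijective_mfderiv (φ.map_target hq)).1
  refine (hφ.comm _ (φ.map_target hq) _).trans ?_
  have h1 := hφ.isSmoothChart.mfderiv_coordVec hq v
  have h2 := hφ.isSmoothChart.mfderiv_coordVec hq v.swap
  exact (congrArg Prod.swap h1).trans h2.symm

theorem I_coordVec_nullVec {q : CModel n} (hq : q ∈ φ.target) {s : ℝ} (hs : s * s = 1)
    (a : Fin n) : J.I (φ.symm q) (coordVec φ q (nullVec n s a)) =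
      s • coordVec φ q (nullVec n s a) := by
  have h : (nullVec n s a).swap = s • nullVec n s a := by
    ext b
    · simp [nullVec, dirX, dirY]; ring
    · have : (1 / 2 : ℝ) = s * (1 / 2 * s) := by linear_combination (- 1 / 2) * hs
      simp only [nullVec, dirX, dirY]
      rcases eq_or_ne b a with rfl | hb
      · simpa using this
      · simp [hb]
  rw [I_coordVec hφ hq, h, coordVec_smul]

theorem hat_coordVec_nullVec {q : CModel n} (hq : q ∈ φ.target) (s : ℝ) (a : Fin n) :
    hat J (φ.symm q) (coordVec φ q (nullVec n s a)) =
      ((1 / 2 : ℝ) • (1 + s • e : ParaComplex)) • frame φ q a := by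
  have h1 : J.I (φ.symm q) (coordVec φ q (dirX a)) = coordVec φ q (dirY a) :=
    I_coordVec hφ hq (dirX a)
  have h2 : frame φ q a = hat J (φ.symm q) (coordVec φ q (dirX a)) := by
    rw [hat_apply, h1]
    rfl
  rw [nullVec, coordVec_smul, coordVec_add, coordVec_smul, map_smul, map_add, map_smul, ← h1, hat_I,
    ← h2, smul_assoc, add_smul, one_smul, smul_assoc]

/-- In null directions, the real metric is the orthogonal sum of the two projections of the
components of the para-holomorphic metric. -/
theorem metricComponents_nullBasis {q : CModel n} (hq : q ∈ φ.target) :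
    metricComponents G φ (nullBasis n) q = Matrix.fromBlocks
      ((G.components φ q).map (proj 1 (by norm_num))) 0 0
      ((G.components φ q).map (proj (-1) (by norm_num))) := by
  have h (s t : ℝ) (a b : Fin n) : G.real (φ.symm q) (coordVec φ q (nullVec n s a))
      (coordVec φ q (nullVec n t b)) = 1 / 2 * ((1 + s * t) * (G.components φ q a b).re +
        (s + t) * (G.components φ q a b).im) := by
    rw [ParaComplexMetric.real_apply, hat_coordVec_nullVec hφ hq, hat_coordVec_nullVec hφ hq,
      map_smul, LinearMap.map_smul, LinearMap.smul_apply]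
    change 2 * (_ • _ • (G.components φ q a b)).re = _
    have h1 : (1 : ParaComplex).re = 1 := rfl
    have h2 : (1 : ParaComplex).im = 0 := rfl
    simp [e, h1, h2]
    ring
  ext i j
  rcases i with a | a <;> rcases j with b | b <;>
  simp only [metricComponents, Matrix.of_apply, nullBasis_inl, nullBasis_inr, h,
    Matrix.fromBlocks_apply₁₁, Matrix.fromBlocks_apply₁₂, Matrix.fromBlocks_apply₂₁,
    Matrix.fromBlocks_apply₂₂, Matrix.map_apply, proj_apply, Matrix.zero_apply] <;>
  ring

/-- Near a point, the metric in null coordinates is the pullback of its expression in the preferred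
chart, in which the real Ricci tensor is defined. -/
theorem isPullbackAt_nullBasis {p : CModel n} (hp : p ∈ φ.target) :
    IsPullbackAt (stdBasis n) (nullBasis n)
      (metricComponents G (chartAt (RModel n) (φ.symm p)) (stdBasis n))
      (fun q => Matrix.fromBlocks ((G.components φ q).map (proj 1 (by norm_num))) 0 0
        ((G.components φ q).map (proj (-1) (by norm_num))))
      (chartAt (RModel n) (φ.symm p) ∘ φ.symm) p := by
  set c := chartAt (RModel n) (φ.symm p) with hc
  have hcA : c ∈ IsManifold.maximalAtlas (𝓡 (2 * n)) ∞ M :=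
    IsManifold.chart_mem_maximalAtlas _
  have hcs := isSmoothChart_of_mem_maximalAtlas hcA
  have hφs := hφ.isSmoothChart
  have hpc : φ.symm p ∈ c.source := mem_chart_source _ _
  have hev : ∀ᶠ q in 𝓝 p, q ∈ φ.target ∧ φ.symm q ∈ c.source :=
    Filter.Eventually.and (φ.open_target.mem_nhds hp)
      ((φ.continuousAt_symm hp).eventually (c.open_source.mem_nhds hpc))
  exact
    { contDiffAt_map := hφs.contDiffAt_transition hcs hp hpc
      bijective := hev.mono fun q hq => hφs.bijective_fderiv_transition hcs hq.1 hq.2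
      contDiffAt := contDiffAt_realComponents G hcA (c.map_source hpc)
      symm := Eventually.of_forall fun q => metricComponents_symm G _ q
      det_ne_zero := det_metricComponents_ne_zero G hcs _ (c.map_source hpc)
      eq := hev.mono fun q hq i j => by
        rw [formOf_metricComponents, real_transition G hφs hcs hq.1 hq.2,
          ← metricComponents_nullBasis G hφ hq.1]
        rfl }

theorem contDiffAt_proj_components {p : CModel n} (hp : p ∈ φ.target) {s : ℝ} (hs : s * s = 1)
    (a b : Fin n) : ContDiffAt ℝ ∞ (fun q => proj s hs (G.components φ q a b)) p := by
  have h := (isPullbackAt_nullBasis G hφ hp).contDiffAt_pullback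
  rcases mul_self_eq_one_iff.1 hs with rfl | rfl
  exacts [h (.inl a) (.inl b), h (.inr a) (.inr b)]

theorem contDiffAt_re_components {p : CModel n} (hp : p ∈ φ.target) (a b : Fin n) :
    ContDiffAt ℝ ∞ (fun q => (G.components φ q a b).re) p := by
  have h : (fun q => (G.components φ q a b).re) = fun q => 1 / 2 *
      (proj 1 (by norm_num) (G.components φ q a b) +
        proj (-1) (by norm_num) (G.components φ q a b)) := by
    ext q
    simp only [proj_apply]
    ring
  rw [h]
  exact contDiffAt_const.mul ((contDiffAt_proj_components G hφ hp _ a b).add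
    (contDiffAt_proj_components G hφ hp _ a b))

theorem contDiffAt_im_components {p : CModel n} (hp : p ∈ φ.target) (a b : Fin n) :
    ContDiffAt ℝ ∞ (fun q => (G.components φ q a b).im) p := by
  have h : (fun q => (G.components φ q a b).im) = fun q => 1 / 2 *
      (proj 1 (by norm_num) (G.components φ q a b) -
        proj (-1) (by norm_num) (G.components φ q a b)) := by
    ext q
    simp only [proj_apply]
    ring
  rw [h]
  exact contDiffAt_const.mul ((contDiffAt_proj_components G hφ hp _ a b).sub
    (contDiffAt_proj_components G hφ hp _ a b))

theorem det_proj_components_ne_zero {p : CModel n} (hp : p ∈ φ.target) {s : ℝ} (hs : s * s = 1) :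
    ((G.components φ p).map (proj s hs)).det ≠ 0 := by
  have h := (isPullbackAt_nullBasis G hφ hp).det_pullback_ne_zero
  rw [Matrix.det_fromBlocks_zero₂₁] at h
  rcases mul_self_eq_one_iff.1 hs with rfl | rfl
  exacts [left_ne_zero_of_mul h, right_ne_zero_of_mul h]

/-- The components of a para-holomorphic metric project to functions of one half of the null
coordinates. -/
theorem proj_components_mem_constAlong (hG : G.IsParaHolomorphic) {p : CModel n}
    (hp : p ∈ φ.target) {s : ℝ} (hs : s * s = 1) (a b : Fin n) :
    (fun q => (G.components φ q).map (proj s hs) a b) ∈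
      constAlong (Set.range (nullVec n (-s))) p := by
  refine ⟨contDiffAt_proj_components G hφ hp hs a b, ?_⟩
  filter_upwards [φ.open_target.mem_nhds hp] with q hq
  rintro _ ⟨c, rfl⟩
  have h := proj_dzbar hs ((contDiffAt_re_components G hφ hq a b).differentiableAt (by simp))
    ((contDiffAt_im_components G hφ hq a b).differentiableAt (by simp)) c
  rw [hG φ hφ q hq a b c, map_zero] at h
  exact h.symm

/-- In null directions, the Ricci tensor of the real metric is the orthogonal sum of the two
projections of the Ricci tensor of the para-holomorphic metric. -/
theorem realRicci_nullBasis (hG : G.IsParaHolomorphic) {p : CModel n} (hp : p ∈ φ.target)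
    (i j : Fin n ⊕ Fin n) :
    G.realRicci (φ.symm p) (coordVec φ p (nullBasis n i)) (coordVec φ p (nullBasis n j)) =
      Matrix.fromBlocks
        (Matrix.of fun a b => proj 1 (by norm_num) (ricci dz (G.components φ) a b p)) 0 0
        (Matrix.of fun a b => proj (-1) (by norm_num) (ricci dz (G.components φ) a b p)) i j := by
  have hcs : IsSmoothChart n (chartAt (RModel n) (φ.symm p)) :=
    isSmoothChart_of_mem_maximalAtlas (IsManifold.chart_mem_maximalAtlas _)
  have h1 (v : CModel n) :=
    hφ.isSmoothChart.fderiv_transition hcs hp (mem_chart_source _ (φ.symm p)) v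
  have h2 := (isPullbackAt_nullBasis G hφ hp).ricci_eq i j
  have hl : nullBasis n ∘ Sum.inl = nullVec n 1 := funext nullBasis_inl
  have hr : nullBasis n ∘ Sum.inr = nullVec n (-1) := funext nullBasis_inr
  rw [ricci_fromBlocks, hl, hr] at h2
  · rw [ParaComplexMetric.realRicci, realComponents_eq, partialR_eq]
    simp only [proj_ricci _ (contDiffAt_re_components G hφ hp) (contDiffAt_im_components G hφ hp)
      fun s hs => det_proj_components_ne_zero G hφ hp hs]
    rw [h2, h1, h1]
    rfl
  · intro a b
    rw [hr]
    exact proj_components_mem_constAlong G hφ hG hp _ a b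
  · intro a b
    rw [hl, show nullVec n 1 = nullVec n (- -1) by rw [neg_neg]]
    exact proj_components_mem_constAlong G hφ hG hp _ a b
  · exact det_proj_components_ne_zero G hφ hp _
  · exact det_proj_components_ne_zero G hφ hp _

theorem einsteinForm_nullBasis (l₁ l₂ : ℝ) {p : CModel n} (hp : p ∈ φ.target)
    (i j : Fin n ⊕ Fin n) :
    einsteinForm G l₁ l₂ (φ.symm p) (coordVec φ p (nullBasis n i)) (coordVec φ p (nullBasis n j)) =
      Matrix.fromBlocks
        (Matrix.of fun a b => proj 1 (by norm_num) (⟨l₁, l₂⟩ * G.components φ p a b)) 0 0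
        (Matrix.of fun a b => proj (-1) (by norm_num) (⟨l₁, l₂⟩ * G.components φ p a b)) i j := by
  have h : G.real (φ.symm p) (coordVec φ p (nullBasis n i)) (coordVec φ p (nullBasis n j)) =
    metricComponents G φ (nullBasis n) p i j := rfl
  rw [metricComponents_nullBasis G hφ hp] at h
  rw [einsteinForm_apply]
  rcases j with b | b
  · have hI := I_coordVec_nullVec hφ hp (s := 1) (by norm_num) b
    rw [← nullBasis_inl] at hI
    rw [hI, map_smul, h]
    rcases i with a | a
    · simp [proj_apply]; ring
    · simp
  · have hI := I_coordVec_nullVec hφ hp (s := -1) (by norm_num) b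
    rw [← nullBasis_inr] at hI
    rw [hI, map_smul, h]
    rcases i with a | a
    · simp
    · simp [proj_apply]; ring

/-- The pointwise equivalence of the two Einstein equations. -/
theorem einstein_iff_at (hG : G.IsParaHolomorphic) (l₁ l₂ : ℝ) {p : CModel n}
    (hp : p ∈ φ.target) :
    (∀ a b, ricci dz (G.components φ) a b p = ⟨l₁, l₂⟩ * G.components φ p a b) ↔
      ∀ X Y : T n (φ.symm p), G.realRicci (φ.symm p) X Y =
        l₁ * G.real (φ.symm p) X Y + l₂ * G.real (φ.symm p) X (J.I (φ.symm p) Y) := by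
  constructor
  · intro h X Y
    obtain ⟨u, rfl⟩ := hφ.isSmoothChart.coordVec_surjective hp X
    obtain ⟨v, rfl⟩ := hφ.isSmoothChart.coordVec_surjective hp Y
    rw [← einsteinForm_apply]
    refine bilin_ext_coordVec (nullBasis n) (fun i j => ?_) u v
    rw [realRicci_nullBasis G hφ hG hp, einsteinForm_nullBasis G hφ l₁ l₂ hp]
    simp only [h]
  · intro h a b
    have h' (i j) := (realRicci_nullBasis G hφ hG hp i j).symm.trans
      ((h _ _).trans (einsteinForm_nullBasis G hφ l₁ l₂ hp i j))
    refine paraComplex_ext_proj fun s hs => ?_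
    rcases mul_self_eq_one_iff.1 hs with rfl | rfl
    exacts [h' (.inl a) (.inl b), h' (.inr a) (.inr b)]

end ParaHolCoordinates

end

section

variable {n : ℕ} {M : Type*} [TopologicalSpace M] [ChartedSpace (RModel n) M]
  [IsManifold (𝓡 (2 * n)) ∞ M] (J : ParaComplexStructure n M)

/-! ### Existence of para-holomorphic coordinates -/

section Existence

theorem isCompl_eigenspaces (x : M) :
    IsCompl (Module.End.eigenspace (J.I x).toLinearMap 1)
      (Module.End.eigenspace (J.I x).toLinearMap (-1)) := by
  rw [isCompl_iff, Submodule.disjoint_def, codisjoint_iff, Submodule.eq_top_iff']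
  constructor
  · intro v h1 h2
    rw [Module.End.mem_eigenspace_iff, one_smul] at h1
    rw [Module.End.mem_eigenspace_iff, h1, neg_smul, one_smul] at h2
    have h3 : (2 : ℝ) • v = 0 := by
      nth_rewrite 1 [two_smul, h2]
      exact neg_add_cancel v
    exact (smul_eq_zero.1 h3).resolve_left two_ne_zero
  · intro v
    rw [Submodule.mem_sup]
    refine ⟨(1 / 2 : ℝ) • (v + J.I x v), ?_, (1 / 2 : ℝ) • (v - J.I x v), ?_, by module⟩
    · rw [Module.End.mem_eigenspace_iff]
      change J.I x _ = _
      rw [map_smul, map_add, J.sq]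
      module
    · rw [Module.End.mem_eigenspace_iff]
      change J.I x _ = _
      rw [map_smul, map_sub, J.sq]
      module

theorem finrank_T (x : M) : finrank ℝ (T n x) = 2 * n :=
  finrank_euclideanSpace_fin (𝕜 := ℝ) (n := 2 * n)

theorem finrank_eigenspace_one (x : M) :
    finrank ℝ (Module.End.eigenspace (J.I x).toLinearMap 1) = n := by
  have h := Submodule.finrank_add_eq_of_isCompl (isCompl_eigenspaces J x)
  rw [← J.finrank_eq, finrank_T] at h
  omega

/-- A distribution of rank `n` which is constant in a chart is there the kernel of the differential
of an `ℝⁿ`-valued function. -/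
theorem exists_defining_map {D : ∀ x : M, Submodule ℝ (T n x)} (hD : IsIntegrable D) (x : M)
    (hn : finrank ℝ (D x) = n) :
    ∃ φ ∈ IsManifold.maximalAtlas (𝓡 (2 * n)) ∞ M, x ∈ φ.source ∧
      ∃ L : RModel n →L[ℝ] (Fin n → ℝ), ∀ y ∈ φ.source, ∀ v : T n y,
        v ∈ D y ↔ L (mfderiv (𝓡 (2 * n)) (𝓡 (2 * n)) φ y v) = 0 := by
  obtain ⟨φ, hφ, hx, W, hW⟩ := hD x
  have hbij := (isSmoothChart_of_mem_maximalAtlas hφ).bijective_mfderiv hx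
  let d : T n x →ₗ[ℝ] RModel n := (mfderiv (𝓡 (2 * n)) (𝓡 (2 * n)) φ x).toLinearMap
  have hmap : W = (D x).map d := by
    ext w
    rw [Submodule.mem_map]
    constructor
    · intro hw
      obtain ⟨v, rfl⟩ := hbij.2 w
      exact ⟨v, (hW x hx v).2 hw, rfl⟩
    · rintro ⟨v, hv, rfl⟩
      exact (hW x hx v).1 hv
  have hWn : finrank ℝ W = n := by
    rw [hmap]
    exact (LinearEquiv.finrank_eq (Submodule.equivMapOfInjective d hbij.1 (D x))).symm.trans hn
  have hq : finrank ℝ (RModel n ⧸ W) = finrank ℝ (Fin n → ℝ) := by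
    rw [Submodule.finrank_quotient, hWn, finrank_euclideanSpace_fin, finrank_fin_fun]
    omega
  refine ⟨φ, hφ, hx, LinearMap.toContinuousLinearMap
    ((LinearEquiv.ofFinrankEq _ _ hq).toLinearMap ∘ₗ W.mkQ), fun y hy v => ?_⟩
  rw [hW y hy v]
  exact ((LinearEquiv.map_eq_zero_iff _).trans (Submodule.Quotient.mk_eq_zero W)).symm

/-- Every point has para-holomorphic coordinates around it: functions `u`, `v` with values in `ℝⁿ`
whose differentials have the eigenspaces of `I` for `-1` and `1` as kernels are the null
coordinates `x + y` and `x - y`. -/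
theorem exists_isParaHolChart (x : M) :
    ∃ φ : OpenPartialHomeomorph M (CModel n), IsParaHolChart J φ ∧ x ∈ φ.source := by
  obtain ⟨φ₁, hφ₁, hx₁, L₁, hL₁⟩ := exists_defining_map J.integrable_minus x
    ((J.finrank_eq x).symm.trans (finrank_eigenspace_one J x))
  obtain ⟨φ₂, hφ₂, hx₂, L₂, hL₂⟩ := exists_defining_map J.integrable_plus x
    (finrank_eigenspace_one J x)
  have hs₁ := isSmoothChart_of_mem_maximalAtlas hφ₁
  have hs₂ := isSmoothChart_of_mem_maximalAtlas hφ₂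
  have hc : IsSmoothChart n (chartAt (RModel n) x) :=
    isSmoothChart_of_mem_maximalAtlas (IsManifold.chart_mem_maximalAtlas x)
  set c := chartAt (RModel n) x
  have hxc : x ∈ c.source := mem_chart_source _ x
  let N : ((Fin n → ℝ) × (Fin n → ℝ)) →L[ℝ] CModel n :=
    LinearMap.toContinuousLinearMap (nullEquiv n).toLinearMap
  let S : (RModel n × RModel n) →L[ℝ] CModel n := N.comp (L₁.prodMap L₂)
  let Φ : M → CModel n := fun y => S (φ₁ y, φ₂ y)
  let d₁ (y : M) : T n y →L[ℝ] RModel n := mfderiv (𝓡 (2 * n)) (𝓡 (2 * n)) φ₁ y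
  let d₂ (y : M) : T n y →L[ℝ] RModel n := mfderiv (𝓡 (2 * n)) (𝓡 (2 * n)) φ₂ y
  have hΦ (y : M) (h₁ : y ∈ φ₁.source) (h₂ : y ∈ φ₂.source) :
      HasMFDerivAt (𝓡 (2 * n)) 𝓘(ℝ, CModel n) Φ y (S.comp ((d₁ y).prod (d₂ y))) := by
    have k₁ := (hs₁.mdifferentiable.mdifferentiableAt h₁).hasMFDerivAt
    have k₂ := (hs₂.mdifferentiable.mdifferentiableAt h₂).hasMFDerivAt
    have k : HasMFDerivAt (𝓡 (2 * n)) 𝓘(ℝ, RModel n × RModel n) (fun y => (φ₁ y, φ₂ y)) y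
        ((d₁ y).prod (d₂ y)) := ⟨k₁.1.prodMk k₂.1, k₁.2.prodMk k₂.2⟩
    exact HasMFDerivAt.comp (g := S) y S.hasMFDerivAt k
  have hΦs (y : M) (h₁ : y ∈ φ₁.source) (h₂ : y ∈ φ₂.source) :
      ContMDiffAt (𝓡 (2 * n)) 𝓘(ℝ, CModel n) ∞ Φ y :=
    S.contMDiff.contMDiffAt.comp y (ContMDiffAt.prodMk_space
      (hs₁.smooth.contMDiffAt (φ₁.open_source.mem_nhds h₁))
      (hs₂.smooth.contMDiffAt (φ₂.open_source.mem_nhds h₂)))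
  have hinj (y : M) (h₁ : y ∈ φ₁.source) (h₂ : y ∈ φ₂.source) (X : T n y)
      (hX : S (d₁ y X, d₂ y X) = 0) : X = 0 := by
    have h0 : (L₁ (d₁ y X), L₂ (d₂ y X)) = ((0, 0) : (Fin n → ℝ) × (Fin n → ℝ)) :=
      (nullEquiv n).map_eq_zero_iff.1 hX
    rw [Prod.mk.injEq] at h0
    exact (Submodule.disjoint_def.1 (isCompl_eigenspaces J y).disjoint) X
      ((hL₂ y h₂ X).2 h0.2) ((hL₁ y h₁ X).2 h0.1)
  let f : RModel n → CModel n := Φ ∘ c.symm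
  let V : Set (RModel n) := c.target ∩ c.symm ⁻¹' (φ₁.source ∩ φ₂.source)
  have hV : IsOpen V := c.isOpen_inter_preimage_symm (φ₁.open_source.inter φ₂.open_source)
  have hf (q : RModel n) (hq : q ∈ V) : ContDiffAt ℝ ∞ f q := by
    rw [← contMDiffAt_iff_contDiffAt]
    exact (hΦs _ hq.2.1 hq.2.2).comp q (hc.smooth_symm.contMDiffAt (c.open_target.mem_nhds hq.1))
  have hf' (q : RModel n) (hq : q ∈ V) :
      ∃ f' : RModel n ≃L[ℝ] CModel n, HasFDerivAt f (f' : RModel n →L[ℝ] CModel n) q := by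
    have hd := ((hf q hq).differentiableAt (by simp)).hasFDerivAt
    have hcomp (u : RModel n) : fderiv ℝ f q u =
        S (d₁ _ (coordVec c q u), d₂ _ (coordVec c q u)) := by
      have := (hΦ _ hq.2.1 hq.2.2).comp q
        (hc.mdifferentiable.mdifferentiableAt_symm hq.1).hasMFDerivAt
      rw [← mfderiv_eq_fderiv, this.mfderiv]
      rfl
    have hi : Function.Injective (fderiv ℝ f q).toLinearMap := by
      rw [← LinearMap.ker_eq_bot, LinearMap.ker_eq_bot']
      intro u hu
      have h0 := hinj _ hq.2.1 hq.2.2 _ ((hcomp u).symm.trans hu)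
      exact hc.coordVec_injective hq.1 (h0.trans (coordVec_zero q).symm)
    have hdim : finrank ℝ (RModel n) = finrank ℝ (CModel n) := by
      rw [finrank_euclideanSpace_fin, Module.finrank_prod, finrank_fin_fun]
      omega
    refine ⟨(LinearEquiv.ofInjectiveOfFinrankEq _ hi hdim).toContinuousLinearEquiv, ?_⟩
    exact hd
  have hxV : c x ∈ V := ⟨c.map_source hxc, by
    rw [Set.mem_preimage, c.left_inv hxc]
    exact ⟨hx₁, hx₂⟩⟩
  obtain ⟨f₀, hf₀⟩ := hf' _ hxV
  -- Restricting to `V`, where `f` is smooth with invertible derivative, makes the inverse smooth on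
  -- the whole target.
  let Ψ := ((hf _ hxV).toOpenPartialHomeomorph f hf₀ (by simp)).restrOpen V hV
  have hΨ : ⇑Ψ = f := rfl
  have hΨs : Ψ.source ⊆ V := Set.inter_subset_right
  have hev (y : M) (hy : y ∈ (c.trans Ψ).source) : (c.trans Ψ : M → CModel n) =ᶠ[𝓝 y] Φ := by
    filter_upwards [c.open_source.mem_nhds hy.1] with z hz
    exact congrArg Φ (c.left_inv hz)
  have hmem (y : M) (hy : y ∈ (c.trans Ψ).source) : y ∈ φ₁.source ∧ y ∈ φ₂.source := by
    have h := (hΨs hy.2).2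
    rw [Set.mem_preimage, show c.symm (c.symm.symm y) = y from c.left_inv hy.1] at h
    exact h
  refine ⟨c.trans Ψ, ⟨?_, ?_, ?_⟩, ?_⟩
  · intro y hy
    exact ((hΦs y (hmem y hy).1 (hmem y hy).2).congr_of_eventuallyEq
      (hev y hy)).contMDiffWithinAt
  · intro q hq
    rw [OpenPartialHomeomorph.trans_target] at hq
    have hqV := hΨs (Ψ.map_target hq.1)
    obtain ⟨f', hf'⟩ := hf' _ hqV
    have h1 : ContDiffAt ℝ ∞ Ψ.symm q := Ψ.contDiffAt_symm hq.1 hf' (hf _ hqV)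
    exact ((hc.smooth_symm.contMDiffAt (c.open_target.mem_nhds hqV.1)).comp q
      (contMDiffAt_iff_contDiffAt.2 h1)).contMDiffWithinAt
  · intro y hy v
    obtain ⟨h₁, h₂⟩ := hmem y hy
    have hd (X : T n y) : (mfderiv (𝓡 (2 * n)) 𝓘(ℝ, CModel n) (c.trans Ψ) y X : CModel n) =
        S (d₁ y X, d₂ y X) := by
      rw [(hev y hy).mfderiv_eq, (hΦ y h₁ h₂).mfderiv]
      rfl
    -- `I v - v` is an eigenvector for `-1`, and `I v + v` one for `1`.
    have e₁ : L₁ (d₁ y (J.I y v)) = L₁ (d₁ y v) := by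
      rw [← sub_eq_zero, ← map_sub, ← map_sub]
      refine (hL₁ y h₁ _).1 ?_
      rw [Module.End.mem_eigenspace_iff]
      change J.I y _ = _
      rw [map_sub, J.sq]
      module
    have e₂ : L₂ (d₂ y (J.I y v)) = -L₂ (d₂ y v) := by
      rw [← sub_eq_zero, sub_neg_eq_add, ← map_add, ← map_add]
      refine (hL₂ y h₂ _).1 ?_
      rw [Module.End.mem_eigenspace_iff]
      change J.I y _ = _
      rw [map_add, J.sq]
      module
    refine (hd _).trans (Eq.trans ?_ (congrArg Prod.swap (hd v)).symm)
    change nullEquiv n (L₁ (d₁ y (J.I y v)), L₂ (d₂ y (J.I y v))) =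
      (nullEquiv n (L₁ (d₁ y v), L₂ (d₂ y v))).swap
    rw [e₁, e₂]
    simp [nullEquiv, sub_eq_add_neg]
  · exact ⟨hxc, (hf _ hxV).mem_toOpenPartialHomeomorph_source hf₀ (by simp), hxV⟩

end Existence

end

section

variable {n : ℕ} {M : Type*} [TopologicalSpace M] [ChartedSpace (RModel n) M]
  [IsManifold (𝓡 (2 * n)) ∞ M] (J : ParaComplexStructure n M)

/-! ### The two scalar curvatures -/

section Traces

theorem trace_id_T (x : M) : LinearMap.trace ℝ (T n x) LinearMap.id = 2 * n := by
  rw [LinearMap.trace_id, finrank_T]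
  push_cast
  rfl

/-- The trace of `I` vanishes, as its two eigenspaces have the same dimension. -/
theorem trace_I (x : M) : LinearMap.trace ℝ (T n x) (J.I x).toLinearMap = 0 := by
  let P : T n x →ₗ[ℝ] T n x := (1 / 2 : ℝ) • (LinearMap.id + (J.I x).toLinearMap)
  have hP : LinearMap.IsProj (Module.End.eigenspace (J.I x).toLinearMap 1) P := by
    constructor
    · intro v
      rw [Module.End.mem_eigenspace_iff]
      change J.I x ((1 / 2 : ℝ) • (v + J.I x v)) = (1 : ℝ) • (1 / 2 : ℝ) • (v + J.I x v)
      rw [map_smul, map_add, J.sq]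
      module
    · intro v hv
      rw [Module.End.mem_eigenspace_iff] at hv
      have hv' : J.I x v = (1 : ℝ) • v := hv
      change (1 / 2 : ℝ) • (v + J.I x v) = v
      rw [hv']
      module
  have h := hP.trace
  rw [finrank_eigenspace_one, map_smul, map_add, trace_id_T, smul_eq_mul] at h
  linarith

variable {J} (G : ParaComplexMetric J)

theorem real_I_right (x : M) (X Y : T n x) : G.real x X (J.I x Y) = G.real x (J.I x X) Y := by
  rw [ParaComplexMetric.real_apply, ParaComplexMetric.real_apply, hat_I, hat_I, map_smul,
    map_smul, LinearMap.smul_apply]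

/-- The real Einstein equation says `Q = l₁ Id + l₂ I`. -/
theorem ricciOperator_eq {l₁ l₂ : ℝ} {x : M} (h : ∀ X Y : T n x,
      G.realRicci x X Y = l₁ * G.real x X Y + l₂ * G.real x X (J.I x Y)) :
    G.ricciOperator x = l₁ • LinearMap.id + l₂ • (J.I x).toLinearMap := by
  ext X
  rw [← sub_eq_zero]
  refine (G.real_nondegenerate x).1 _ fun Y => ?_
  have h1 : G.real x (G.ricciOperator x X) Y = G.realRicci x X Y :=
    LinearMap.BilinForm.symmCompOfNondegenerate_left_apply _ (G.real_nondegenerate x) Y X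
  have h2 : G.real x ((l₁ • LinearMap.id + l₂ • (J.I x).toLinearMap : T n x →ₗ[ℝ] T n x) X) Y =
      l₁ * G.real x X Y + l₂ * G.real x (J.I x X) Y := by
    simp
  rw [map_sub, LinearMap.sub_apply, h1, h2, h, real_I_right, sub_self]

theorem scalarK_eq {l₁ l₂ : ℝ} {x : M} (h : ∀ X Y : T n x,
      G.realRicci x X Y = l₁ * G.real x X Y + l₂ * G.real x X (J.I x Y)) :
    G.scalarK x = l₁ * (2 * n) := by
  rw [ParaComplexMetric.scalarK, ricciOperator_eq G h, map_add, map_smul, map_smul, trace_I,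
    trace_id_T, smul_eq_mul, smul_zero, add_zero]

theorem scalarKstar_eq {l₁ l₂ : ℝ} {x : M} (h : ∀ X Y : T n x,
      G.realRicci x X Y = l₁ * G.real x X Y + l₂ * G.real x X (J.I x Y)) :
    G.scalarKstar x = l₂ * (2 * n) := by
  have hI : (J.I x).toLinearMap ∘ₗ (J.I x).toLinearMap = LinearMap.id := by
    ext v
    exact J.sq x v
  rw [ParaComplexMetric.scalarKstar, ricciOperator_eq G h, LinearMap.comp_add, LinearMap.comp_smul,
    LinearMap.comp_smul, LinearMap.comp_id, hI, map_add, map_smul, map_smul, trace_I,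
    trace_id_T, smul_eq_mul, smul_eq_mul, mul_zero, zero_add]

/-- On a manifold of dimension `0` the condition `I ≠ Id` cannot hold. -/
theorem ne_zero_of_point (J : ParaComplexStructure n M) (x : M) : (n : ℝ) ≠ 0 := by
  intro hn
  have hn' : n = 0 := by exact_mod_cast hn
  refine J.ne_id x (ContinuousLinearMap.ext fun v => ?_)
  have h0 : finrank ℝ (T n x) = 0 := by rw [finrank_T, hn']
  have := Module.finrank_zero_iff.1 h0
  exact Subsingleton.elim _ _

/-- Both Einstein conditions can be tested at each point in one para-holomorphic chart. -/
theorem isEinstein_iff (hG : G.IsParaHolomorphic) (l₁ l₂ : ℝ) :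
    G.IsEinstein ⟨l₁, l₂⟩ ↔ ∀ (x : M) (X Y : T n x),
      G.realRicci x X Y = l₁ * G.real x X Y + l₂ * G.real x X (J.I x Y) := by
  constructor
  · intro h x
    obtain ⟨φ, hφ, hx⟩ := exists_isParaHolChart J x
    have h1 := (einstein_iff_at G hφ hG l₁ l₂ (φ.map_source hx)).1
      (h φ hφ _ (φ.map_source hx))
    rwa [φ.left_inv hx] at h1
  · intro h φ hφ p hp
    exact (einstein_iff_at G hφ hG l₁ l₂ hp).2 (h _)

end Traces

end

end ParaHol

end

open ParaHol in
theorem mainTheorem2 (n : ℕ) (M : Type*) [TopologicalSpace M] [ChartedSpace (RModel n) M]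
    [IsManifold (𝓡 (2 * n)) ∞ M] (J : ParaComplexStructure n M)
    (G : ParaComplexMetric J) (hG : G.IsParaHolomorphic) (l₁ l₂ : ℝ) :
    (G.IsEinstein ⟨l₁, l₂⟩ ↔
      ∀ (x : M) (X Y : T n x),
        G.realRicci x X Y = l₁ * G.real x X Y + l₂ * G.real x X (J.I x Y)) ∧
    (G.IsEinstein ⟨l₁, l₂⟩ →
      ∀ x : M, l₁ = G.scalarK x / (2 * n) ∧ l₂ = G.scalarKstar x / (2 * n)) := by
  refine ⟨isEinstein_iff G hG l₁ l₂, fun h x => ?_⟩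
  have hx := (isEinstein_iff G hG l₁ l₂).1 h x
  have hn : (2 * n : ℝ) ≠ 0 := mul_ne_zero two_ne_zero (ne_zero_of_point J x)
  rw [scalarK_eq G hx, scalarKstar_eq G hx, mul_div_cancel_right₀ _ hn,
    mul_div_cancel_right₀ _ hn]
  exact ⟨rfl, rfl⟩
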